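/- **Setting.** Let $\mathrm{AP}$ be a finite set, $\Sigma = 2^{\mathrm{AP}}$, let $\mathfrak T=(V,E,v_I,\lambda)$ be a finite transition system in which every vertex has a successor, with $\lambda\colon V\to\Sigma$, and let $\mathrm{Tr}(\mathfrak T)\subseteq\Sigma^\omega$ be the set of label sequences of its infinite paths starting in $v_I$. Let $k\ge 2$ be even and let $\varphi=\forall\pi_0\exists\pi_1\cdots\forall\pi_{k-2}\exists\pi_{k-1}.\ \psi$ be a HyperLTL sentence with quantifier-free $\psi$. For $w_0,\dots,w_{n-1}$ (finite words of equal length, or infinite words) let $\langle w_0,\dots,w_{n-1}\rangle$ be the word over $\Sigma^n$ whose $m$-th letter is $(w_0(m),\dots,w_{n-1}(m))$. Let $$L=\{\langle t_0,\dots,t_{k-1}\rangle \mid t_i\in \mathrm{Tr}(\mathfrak T)\text{ for all } i<k,\ \{\pi_i\mapsto t_i\}_{i<k}\models\psi\}.$$ **Computable Skolem functions.** $\mathfrak T\models\varphi$ *has computable Skolem functions* if there are $f_i\colon \mathrm{Tr}(\mathfrak T)^{(i+1)/2}\to\mathrm{Tr}(\mathfrak T)$ for odd $i<k$ such that (a)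 $\{\pi_i\mapsto t_i\}_{i<k}\models\psi$ whenever $t_i\in\mathrm{Tr}(\mathfrak T)$ for all even $i$ and $t_i=f_i(t_0,t_2,\dots,t_{i-1})$ for all odd $i$, and (b) for each odd $i$ there is a deterministic three-tape Turing machine (one-way read-only input tape, two-way working tape, one-way write-only output tape) that, for all $t_0,t_2,\dots,t_{i-1}\in\mathrm{Tr}(\mathfrak T)$, started with $\langle t_0,t_2,\dots,t_{i-1}\rangle$ on its input tape, produces $f_i(t_0,t_2,\dots,t_{i-1})$ in the limit on its output tape. **Equivalences.** Let $\mathcal A$ be a (finite, nondeterministic) Büchi automaton with $L(\mathcal A)=L$. Two $k$-tuples $(w_0,\dots,w_{k-1})$, $(w'_0,\dots,w'_{k-1})$ of finite words over $\Sigma$ (of the same length within each tuple) satisfy $\equiv_k$ if for all states $p,q$ of $\mathcal A$ there is a run from $p$ to $q$ on $\langle w_0,\dots,w_{k-1}\rangle$ iff there is one on $\langle w'_0,\dots,w'_{k-1}\rangle$, the same holds for runs visiting an accepting state, and for all $u,v\in V$ and $j<k$ there is a path of $\mathfrak T$ from $u$ to $v$ labeled by $w_j$ iff there is one labeled by $w'_j$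 (the label of a path $u_0u_1\cdots u_n$ being $\lambda(u_0)\cdots\lambda(u_{n-1})$). For $1\le i<k$, $(w_0,\dots,w_{i-1})\equiv_i(w'_0,\dots,w'_{i-1})$ if for every $w_i$ with $|w_i|=|w_0|$ there is $w'_i$ with $|w'_i|=|w'_0|$ such that $(w_0,\dots,w_i)\equiv_{i+1}(w'_0,\dots,w'_i)$, and vice versa. Let $\ell$ be the least positive integer such that every word over $\Sigma$ of length at least $\ell$ has an infinite $\equiv_1$-class; a *block* is a word in $\Sigma^\ell$. Let $\Delta_i=\frac{k-(i-1)}2$ for odd $i$ and $\Delta_i=\Delta_{i+1}+1$ for even $i$. **The game $\mathcal G(\mathfrak T,\varphi)$.** It is played by Player $U$ and a coalition of variable players $1,3,\dots,k-1$ in rounds $r=0,1,2,\dots$, each split into subrounds $(r,0),\dots,(r,k-1)$. In subround $(r,i)$ the player in charge of $\pi_i$ (Player $U$ for even $i$, Player $i$ for odd $i$) picks $\Delta_i$ blocks $t_i^0,\dots,t_i^{\Delta_i-1}$ if $r=0$, and one block $t_i^{\Delta_i-1+r}$ if $r>0$. With $t_i=t_i^0t_i^1t_i^2\cdots$, the variable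 players win the play if $t_i\notin\mathrm{Tr}(\mathfrak T)$ for some even $i$ or $\langle t_0,\dots,t_{k-1}\rangle\in L(\mathcal A)$. A strategy for Player $i$ determines her pick in round $r$ from the blocks picked in rounds $0,\dots,r$ for the variables $\pi_j$ with even $j<i$ only. This information is written as the sequence of columns $n=0,1,\dots,\Delta_0-1+r$, where column $n$ contains those blocks $t_j^n$ ($j<i$ even) with $n<\Delta_j+r$; the strategy is *finite-state* if some finite transducer, on reading this sequence of columns, outputs the prescribed pick with its last transition. A collection of strategies, one for each variable player, is *winning* if the variable players win every play that is consistent with all of them. **Lemma.** A Büchi automaton $\mathcal A$ with $L(\mathcal A)=L$ exists, and for every such $\mathcal A$ the following hold. 1. If the coalition of variable players has a winning collection of finite-state strategies in $\mathcal G(\mathfrak T,\varphi)$, then $\mathfrak T\models\varphi$ has computable Skolem functions. 2. If $\mathfrak T\models\varphi$ has computable Skolem functions, then the coalition of variable players has a winning collection of strategies in $\mathcal G(\mathfrak T,\varphi)$. -/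

import Mathlib

namespace HyperLTL

/-! ### Traces and transition systems -/

/-- Traces are infinite words over the alphabet of all sets of atomic propositions. -/
abbrev Trace (AP : Type) : Type := ℕ → Set AP

/-- A finite transition system in which every vertex has a successor. -/
structure TransitionSystem (AP : Type) where
  V : Type
  finite_V : Finite V
  E : V → V → Prop
  init : V
  label : V → Set AP
  exists_succ : ∀ v, ∃ v', E v v'

/-- The set of traces of a transition system. -/
def TransitionSystem.traces {AP : Type} (T : TransitionSystem AP) : Set (Trace AP) :=
  {t | ∃ ρ : ℕ → T.V, ρ 0 = T.init ∧ (∀ n, T.E (ρ n) (ρ (n + 1))) ∧ ∀ n, t n = T.label (ρ n)}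

/-- There is a path from `u` to `v` labelled by the finite word `w`. As in the definition of
traces, the `j`-th letter is the label of the `j`-th vertex of the path, so that such paths
can be concatenated. -/
def TransitionSystem.HasRun {AP : Type} (T : TransitionSystem AP) {n : ℕ}
    (u : T.V) (w : Fin n → Set AP) (v : T.V) : Prop :=
  ∃ ρ : Fin (n + 1) → T.V, ρ 0 = u ∧ ρ (Fin.last n) = v ∧
    ∀ j : Fin n, T.E (ρ j.castSucc) (ρ j.succ) ∧ w j = T.label (ρ j.castSucc)

/-! ### Büchi automata -/

/-- A (nondeterministic, finite) Büchi automaton over the alphabet `S`. -/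
structure BuchiAutomaton (S : Type) where
  Q : Type
  finite_Q : Finite Q
  init : Q
  δ : Q → S → Set Q
  F : Set Q

/-- The language of infinite words that have a run visiting `F` infinitely often. -/
def BuchiAutomaton.language {S : Type} (A : BuchiAutomaton S) : Set (ℕ → S) :=
  {w | ∃ ρ : ℕ → A.Q, ρ 0 = A.init ∧ (∀ n, ρ (n + 1) ∈ A.δ (ρ n) (w n)) ∧
    {n | ρ n ∈ A.F}.Infinite}

/-- `ρ` is a run from `p` to `q` processing the finite word `w`. -/
def BuchiAutomaton.IsRun {S : Type} (A : BuchiAutomaton S) {n : ℕ}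
    (p : A.Q) (w : Fin n → S) (q : A.Q) (ρ : Fin (n + 1) → A.Q) : Prop :=
  ρ 0 = p ∧ ρ (Fin.last n) = q ∧ ∀ j : Fin n, ρ j.succ ∈ A.δ (ρ j.castSucc) (w j)

/-- There is a run from `p` to `q` processing `w`. -/
def BuchiAutomaton.HasRun {S : Type} (A : BuchiAutomaton S) {n : ℕ}
    (p : A.Q) (w : Fin n → S) (q : A.Q) : Prop :=
  ∃ ρ, A.IsRun p w q ρ

/-- There is a run from `p` to `q` processing `w` that visits an accepting state. -/
def BuchiAutomaton.HasAccRun {S : Type} (A : BuchiAutomaton S) {n : ℕ}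
    (p : A.Q) (w : Fin n → S) (q : A.Q) : Prop :=
  ∃ ρ, A.IsRun p w q ρ ∧ ∃ j, ρ j ∈ A.F

/-! ### HyperLTL -/

/-- Quantifier-free HyperLTL formulas whose trace variables range over `Var`. -/
inductive QFFormula (AP Var : Type) : Type
  | atom (a : AP) (x : Var)
  | neg (ψ : QFFormula AP Var)
  | or (ψ₁ ψ₂ : QFFormula AP Var)
  | next (ψ : QFFormula AP Var)
  | until (ψ₁ ψ₂ : QFFormula AP Var)

/-- Satisfaction of a quantifier-free formula by a trace assignment. -/
def QFFormula.Sat {AP Var : Type} : (Var → Trace AP) → QFFormula AP Var → Prop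
  | P, .atom a x => a ∈ P x 0
  | P, .neg ψ => ¬ Sat P ψ
  | P, .or ψ₁ ψ₂ => Sat P ψ₁ ∨ Sat P ψ₂
  | P, .next ψ => Sat (fun x n => P x (1 + n)) ψ
  | P, .until ψ₁ ψ₂ => ∃ j, Sat (fun x n => P x (j + n)) ψ₂ ∧
      ∀ j' < j, Sat (fun x n => P x (j' + n)) ψ₁

inductive Quantifier : Type
  | all
  | ex

/-- The alternating quantifier prefix `∀ π₀ ∃ π₁ ∀ π₂ ∃ π₃ ⋯` of length `k`. -/
def altPrefix (k : ℕ) (i : Fin k) : Quantifier :=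
  if Even (i : ℕ) then .all else .ex

/-- The existentially quantified variables of a prefix. -/
abbrev ExVar {k : ℕ} (Q : Fin k → Quantifier) : Type := {i : Fin k // Q i = .ex}

/-- The universally quantified variables preceding the variable `i`. -/
abbrev UnivBefore {k : ℕ} (Q : Fin k → Quantifier) (i : Fin k) : Type :=
  {j : Fin k // j < i ∧ Q j = .all}

/-- The merge of a tuple of traces into one infinite word. -/
def merge {AP J : Type} (t : J → Trace AP) : ℕ → (J → Set AP) := fun n j => t j n

/-- A candidate Skolem function for each existentially quantified variable; its arguments are
traces for the universally quantified variables preceding that variable. -/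
abbrev SkolemFamily {AP : Type} (T : Set (Trace AP)) {k : ℕ} (Q : Fin k → Quantifier) : Type :=
  ∀ i : ExVar Q, (UnivBefore Q i.1 → T) → T

/-- The family `f` consists of Skolem functions witnessing `T ⊨ Q₀ π₀ ⋯ Q₍ₖ₋₁₎ π₍ₖ₋₁₎. ψ`:
every assignment that is consistent with `f` satisfies `ψ`. -/
def IsSkolemWitness {AP : Type} (T : Set (Trace AP)) {k : ℕ} (Q : Fin k → Quantifier)
    (ψ : QFFormula AP (Fin k)) (f : SkolemFamily T Q) : Prop :=
  ∀ (P : Fin k → Trace AP) (hP : ∀ i, Q i = .all → P i ∈ T),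
    (∀ i : ExVar Q, P i.1 = f i (fun j => ⟨P j.1, hP j.1 j.2.2⟩)) → ψ.Sat P

/-! ### Computable functions on infinite words -/

/-- A deterministic three-tape Turing machine with input alphabet `I` and output alphabet `O`.
Depending on its state, the current input letter and the current letter of the working tape,
the machine changes its state, writes a letter on the two-way working tape and possibly moves
there, possibly advances to the next letter of the one-way read-only input tape, and possibly
appends a letter to the one-way write-only output tape. The blank of the working tape is
`default`. -/
structure StreamTM (I O : Type) where
  State : Type
  finite_State : Finite State
  Work : Type
  finite_Work : Finite Work
  inhabited_Work : Inhabited Work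
  start : State
  next : State → I → Work → State
  write : State → I → Work → Work
  move : State → I → Work → Option Turing.Dir
  advance : State → I → Work → Bool
  emit : State → I → Work → Option O

attribute [instance] StreamTM.inhabited_Work

/-- Configurations of a machine: state, position on the input tape, working tape, output written
so far. -/
structure StreamTM.Cfg {I O : Type} (M : StreamTM I O) where
  state : M.State
  pos : ℕ
  tape : Turing.Tape M.Work
  output : List O

/-- One computation step on the infinite input `w`. -/
def StreamTM.step {I O : Type} (M : StreamTM I O) (w : ℕ → I) (c : M.Cfg) : M.Cfg :=
  let a := w c.pos
  let b := c.tape.head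
  { state := M.next c.state a b
    pos := if M.advance c.state a b then c.pos + 1 else c.pos
    tape := match M.move c.state a b with
      | none => c.tape.write (M.write c.state a b)
      | some d => (c.tape.write (M.write c.state a b)).move d
    output := c.output ++ (M.emit c.state a b).toList }

/-- The configuration reached after `s` steps on the infinite input `w`. -/
def StreamTM.run {I O : Type} (M : StreamTM I O) (w : ℕ → I) (s : ℕ) : M.Cfg :=
  (M.step w)^[s] { state := M.start, pos := 0, tape := default, output := [] }

/-- Started on `w`, the machine produces the infinite word `y` in the limit. -/
def StreamTM.Produces {I O : Type} (M : StreamTM I O) (w : ℕ → I) (y : ℕ → O) : Prop :=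
  (∀ s, (M.run w s).output = List.ofFn fun p : Fin (M.run w s).output.length => y p) ∧
    ∀ n, ∃ s, n ≤ (M.run w s).output.length

/-- `T ⊨ Q₀ π₀ ⋯ Q₍ₖ₋₁₎ π₍ₖ₋₁₎. ψ` has computable Skolem functions. The machine for the variable
`i` reads the merge of the argument traces; nothing is required of it on inputs outside of the
domain of the Skolem function. -/
def HasComputableSkolem {AP : Type} (T : Set (Trace AP)) {k : ℕ} (Q : Fin k → Quantifier)
    (ψ : QFFormula AP (Fin k)) : Prop :=
  ∃ f : SkolemFamily T Q, IsSkolemWitness T Q ψ f ∧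
    ∀ i : ExVar Q, ∃ M : StreamTM (UnivBefore Q i.1 → Set AP) (Set AP),
      ∀ t : UnivBefore Q i.1 → T, M.Produces (merge fun j => (t j : Trace AP)) (f i t)

/-! ### The automaton for the matrix -/

/-- The set of all merges of `k`-tuples of traces of `T` that satisfy `ψ`. -/
def matrixLanguage {AP : Type} {k : ℕ} (T : TransitionSystem AP) (ψ : QFFormula AP (Fin k)) :
    Set (ℕ → (Fin k → Set AP)) :=
  {w | ∃ P : Fin k → Trace AP, w = merge P ∧ (∀ i, P i ∈ T.traces) ∧ ψ.Sat P}

/-! ### The equivalence relations -/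

/-- `i`-tuples of words of length `n`. -/
abbrev WordTuple (AP : Type) (i n : ℕ) : Type := Fin i → Fin n → Set AP

/-- Two `k`-tuples of finite words (possibly of different lengths `n` and `m`) are
indistinguishable for `A` and `T`. -/
def EquivTop {AP : Type} {k : ℕ} (T : TransitionSystem AP) (A : BuchiAutomaton (Fin k → Set AP))
    {n m : ℕ} (x : WordTuple AP k n) (y : WordTuple AP k m) : Prop :=
  (∀ p q, A.HasRun p (fun c j => x j c) q ↔ A.HasRun p (fun c j => y j c) q) ∧
  (∀ p q, A.HasAccRun p (fun c j => x j c) q ↔ A.HasAccRun p (fun c j => y j c) q) ∧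
  (∀ u v, ∀ j, T.HasRun u (x j) v ↔ T.HasRun u (y j) v)

/-- The relation on `i`-tuples obtained from `EquivTop` by `d` completion steps, where
`i + d = k`. -/
def EquivAux {AP : Type} {k : ℕ} (T : TransitionSystem AP) (A : BuchiAutomaton (Fin k → Set AP))
    {n m : ℕ} : (d i : ℕ) → i + d = k → WordTuple AP i n → WordTuple AP i m → Prop
  | 0, _, h, x, y =>
      EquivTop T A (fun j => x (Fin.cast h.symm j)) (fun j => y (Fin.cast h.symm j))
  | d + 1, i, h, x, y =>
      (∀ w : Fin n → Set AP, ∃ v : Fin m → Set AP,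
        EquivAux T A d (i + 1) ((Nat.add_right_comm i 1 d).trans h)
          (Fin.snoc (α := fun _ => Fin n → Set AP) x w)
          (Fin.snoc (α := fun _ => Fin m → Set AP) y v)) ∧
      (∀ v : Fin m → Set AP, ∃ w : Fin n → Set AP,
        EquivAux T A d (i + 1) ((Nat.add_right_comm i 1 d).trans h)
          (Fin.snoc (α := fun _ => Fin n → Set AP) x w)
          (Fin.snoc (α := fun _ => Fin m → Set AP) y v))

/-- The relation `≡ᵢ` between `i`-tuples of words, for `i ≤ k`. -/
def TupleEquiv {AP : Type} {k : ℕ} (T : TransitionSystem AP) (A : BuchiAutomaton (Fin k → Set AP))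
    (i : ℕ) (hi : i ≤ k) {n m : ℕ} (x : WordTuple AP i n) (y : WordTuple AP i m) : Prop :=
  EquivAux T A (k - i) i (Nat.add_sub_of_le hi) x y

/-- The block length: the least positive `ℓ` such that each word of length at least `ℓ` has an
infinite `≡₁`-class. -/
noncomputable def blockLength {AP : Type} {k : ℕ} (T : TransitionSystem AP)
    (A : BuchiAutomaton (Fin k → Set AP)) (hk : 0 < k) : ℕ :=
  sInf {ℓ | 0 < ℓ ∧ ∀ n, ℓ ≤ n → ∀ w : Fin n → Set AP,
    {v : (m : ℕ) × (Fin m → Set AP) | TupleEquiv T A 1 hk (fun _ => w) (fun _ => v.2)}.Infinite}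

/-! ### The game -/

/-- Blocks are words of length `ℓ`. -/
abbrev Block (AP : Type) (ℓ : ℕ) : Type := Fin ℓ → Set AP

/-- The delay `Δᵢ`: it is `(k - (i - 1)) / 2` for odd `i` and `Δᵢ₊₁ + 1` for even `i`. -/
def delay (k i : ℕ) : ℕ :=
  if Even i then (k - (i + 1 - 1)) / 2 + 1 else (k - (i - 1)) / 2

/-- The number of blocks picked in subround `(r, i)`. -/
def numPicks (k i r : ℕ) : ℕ := if r = 0 then delay k i else 1

/-- The index of the first block picked in subround `(r, i)`. -/
def firstPick (k i r : ℕ) : ℕ := if r = 0 then 0 else delay k i - 1 + r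

/-- What Player `i` has observed when it is her turn in round `r`: for each universally quantified
variable `j` preceding `i`, the blocks picked for `j` in rounds `0, …, r`. -/
abbrev Observation (AP : Type) (k ℓ : ℕ) (i : Fin k) (r : ℕ) : Type :=
  ∀ j : UnivBefore (altPrefix k) i, Fin (delay k j.1 + r) → Block AP ℓ

/-- A strategy for Player `i` maps each observation to the blocks she picks next. -/
abbrev Strategy (AP : Type) (k ℓ : ℕ) (i : Fin k) : Type :=
  ∀ r : ℕ, Observation AP k ℓ i r → Fin (numPicks k i r) → Block AP ℓ

/-- The sequence of columns representing an observation in round `r`: its `n`-th column contains the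
`n`-th block of each observed variable for which that block has already been picked. -/
def Observation.columns {AP : Type} {k ℓ : ℕ} {i : Fin k} {r : ℕ} (h : Observation AP k ℓ i r) :
    List (UnivBefore (altPrefix k) i → Option (Block AP ℓ)) :=
  List.ofFn fun (n : Fin (delay k 0 + r)) j =>
    if hn : (n : ℕ) < delay k j.1 + r then some (h j ⟨n, hn⟩) else none

/-- A deterministic finite transducer with output on the transitions (acceptance plays no role
for finite inputs). -/
structure Transducer (S G : Type) where
  Q : Type
  finite_Q : Finite Q
  init : Q
  δ : Q → S → Q × List G

/-- The output of the transition taken on the last letter of a word. -/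
def Transducer.lastOutput {S G : Type} (D : Transducer S G) (w : List S) : List G :=
  (w.foldl (fun c a => D.δ c.1 a) (D.init, [])).2

/-- A strategy is finite-state if some transducer, after reading the columns of an observation,
produces the blocks prescribed by the strategy. -/
def Strategy.FiniteState {AP : Type} {k ℓ : ℕ} {i : Fin k} (σ : Strategy AP k ℓ i) : Prop :=
  ∃ D : Transducer (UnivBefore (altPrefix k) i → Option (Block AP ℓ)) (Block AP ℓ),
    ∀ (r : ℕ) (h : Observation AP k ℓ i r), D.lastOutput h.columns = List.ofFn (σ r h)

/-- An (infinite) play, given by the blocks `b i n` picked for each variable `i`; the blocks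
picked in subround `(r, i)` are those with indices
`firstPick k i r, …, firstPick k i r + numPicks k i r - 1`. -/
abbrev Play (AP : Type) (k ℓ : ℕ) : Type := Fin k → ℕ → Block AP ℓ

/-- In each round, Player `i` picks the blocks prescribed by `σ`. -/
def Play.Consistent {AP : Type} {k ℓ : ℕ} (b : Play AP k ℓ) (i : Fin k)
    (σ : Strategy AP k ℓ i) : Prop :=
  ∀ (r : ℕ) (p : Fin (numPicks k i r)),
    b i (firstPick k i r + p) = σ r (fun j n => b j.1 n) p

/-- The `i`-th trace of the outcome of a play: the concatenation of the blocks picked for `i`. -/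
def Play.outcome {AP : Type} {k ℓ : ℕ} (hℓ : 0 < ℓ) (b : Play AP k ℓ) (i : Fin k) : Trace AP :=
  fun n => b i (n / ℓ) ⟨n % ℓ, Nat.mod_lt n hℓ⟩

/-- The coalition of variable players wins a play. (For `ℓ = 0`, which is never the block length,
there is no outcome.) -/
def Play.Won {AP : Type} {k ℓ : ℕ} (T : TransitionSystem AP)
    (A : BuchiAutomaton (Fin k → Set AP)) (b : Play AP k ℓ) : Prop :=
  ∃ hℓ : 0 < ℓ, (∃ i, altPrefix k i = .all ∧ b.outcome hℓ i ∉ T.traces) ∨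
    merge (b.outcome hℓ) ∈ A.language

/-- A collection of strategies, one for each variable player. -/
abbrev StrategyCollection (AP : Type) (k ℓ : ℕ) : Type :=
  ∀ i : ExVar (altPrefix k), Strategy AP k ℓ i.1

/-- A collection is winning if every play consistent with all its strategies is won. -/
def StrategyCollection.Winning {AP : Type} {k ℓ : ℕ} (T : TransitionSystem AP)
    (A : BuchiAutomaton (Fin k → Set AP)) (σ : StrategyCollection AP k ℓ) : Prop :=
  ∀ b : Play AP k ℓ, (∀ i, b.Consistent i.1 (σ i)) → b.Won T A

end HyperLTL

namespace HyperLTL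

/-! ### Finite index of the equivalence relations -/

/-! The matrix language is Büchi recognizable by a tableau construction: guess the truth values of
the subformulas and run `k` copies of the transition system alongside.

From strategies to Skolem functions: a strategy sees universal moves only, so fixing the universal
traces fixes a play, and its outcome for the variable `i` is a function of the universal traces
before `i`. Winning puts the merged outcome into the language of the automaton, hence all components
are traces and they satisfy the matrix. A finite transducer fed from a bounded window of the input
computes this function (`Strategy.FiniteState.exists_streamTM`).

From Skolem functions to strategies: whatever a machine has written depends on a finite prefix of
its input, and compactness of the path space yields a uniform modulus `μ`
(`exists_uniform_modulus`). It may grow arbitrarily fast, whereas the game grants only constant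
lookahead. The players therefore simulate a game in which each block is replaced by an equivalent
word that is as long as needed; such words exist because words of block length have infinite
classes. The `n`-th long word is made longer than `μ` of its starting position, so that `n + 1` long
words determine the Skolem values on the first `n`, and one block of lookahead per existential
variable suffices. Along the prefix, universal blocks are stretched to long words and Skolem traces
are shrunk to blocks, keeping the tuples equivalent (`Simulation.stage_equiv`);
`Simulation.stage_congr` shows that no unseen block is used. Finally, equivalence carries paths of
the transition system from the blocks to the long words, and an accepting run from the long words
back to the blocks. -/

theorem exists_finite_classification {AP : Type} {k : ℕ} (T : TransitionSystem AP)
    (A : BuchiAutomaton (Fin k → Set AP)) (d : ℕ) :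
    ∀ (i : ℕ) (h : i + d = k), ∃ (C : Type) (_ : Finite C) (τ : (n : ℕ) → WordTuple AP i n → C),
      ∀ (n m : ℕ) (x : WordTuple AP i n) (y : WordTuple AP i m),
        EquivAux T A d i h x y ↔ τ n x = τ m y := by
  induction d with
  | zero =>
    intro i h
    have := A.finite_Q
    have := T.finite_V
    refine ⟨Set (A.Q × A.Q) × Set (A.Q × A.Q) × Set (T.V × T.V × Fin k), inferInstance,
      fun n x => ({c | A.HasRun c.1 (fun c j => x (Fin.cast h.symm j) c) c.2},
        {c | A.HasAccRun c.1 (fun c j => x (Fin.cast h.symm j) c) c.2},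
        {c | T.HasRun c.1 (x (Fin.cast h.symm c.2.2)) c.2.1}), ?_⟩
    intro n m x y
    simp only [EquivAux, EquivTop, Prod.mk.injEq, Set.ext_iff, Set.mem_ofPred_eq, Prod.forall]
  | succ d ih =>
    intro i h
    obtain ⟨C, hC, τ, hτ⟩ := ih (i + 1) ((Nat.add_right_comm i 1 d).trans h)
    -- A tuple is classified by the set of classes that its one-word extensions realize; the
    -- back-and-forth condition is equality of these sets.
    refine ⟨Set C, inferInstance,
      fun n x => Set.range fun w : Fin n → Set AP =>
        τ n (Fin.snoc (α := fun _ => Fin n → Set AP) x w), ?_⟩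
    intro n m x y
    simp only [EquivAux, hτ]
    constructor
    · rintro ⟨h1, h2⟩
      apply Set.Subset.antisymm
      · rintro _ ⟨w, rfl⟩
        obtain ⟨v, hv⟩ := h1 w
        exact ⟨v, hv.symm⟩
      · rintro _ ⟨v, rfl⟩
        obtain ⟨w, hw⟩ := h2 v
        exact ⟨w, hw⟩
    · intro he
      constructor
      · intro w
        have : τ n (Fin.snoc (α := fun _ => Fin n → Set AP) x w) ∈ Set.range fun v =>
            τ m (Fin.snoc (α := fun _ => Fin m → Set AP) y v) := he ▸ ⟨w, rfl⟩
        obtain ⟨v, hv⟩ := this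
        exact ⟨v, hv.symm⟩
      · intro v
        have : τ m (Fin.snoc (α := fun _ => Fin m → Set AP) y v) ∈ Set.range fun w =>
            τ n (Fin.snoc (α := fun _ => Fin n → Set AP) x w) := he ▸ ⟨v, rfl⟩
        exact this

theorem TupleEquiv.symm {AP : Type} {k : ℕ} {T : TransitionSystem AP}
    {A : BuchiAutomaton (Fin k → Set AP)} {i : ℕ} {hi : i ≤ k} {n m : ℕ}
    {x : WordTuple AP i n} {y : WordTuple AP i m} (h : TupleEquiv T A i hi x y) :
    TupleEquiv T A i hi y x := by
  obtain ⟨C, -, τ, hτ⟩ := exists_finite_classification T A (k - i) i (Nat.add_sub_of_le hi)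
  exact (hτ _ _ _ _).2 ((hτ _ _ _ _).1 h).symm

theorem TupleEquiv.exists_snoc {AP : Type} {k : ℕ} {T : TransitionSystem AP}
    {A : BuchiAutomaton (Fin k → Set AP)} {i : ℕ} (hi : i + 1 ≤ k) {n m : ℕ}
    {x : WordTuple AP i n} {y : WordTuple AP i m}
    (h : TupleEquiv T A i ((Nat.le_succ i).trans hi) x y) (w : Fin n → Set AP) :
    ∃ v : Fin m → Set AP, TupleEquiv T A (i + 1) hi
      (Fin.snoc (α := fun _ => Fin n → Set AP) x w)
      (Fin.snoc (α := fun _ => Fin m → Set AP) y v) := by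
  have key : ∀ (d e : ℕ) (hd : i + d = k) (he : i + 1 + e = k), EquivAux T A d i hd x y →
      ∃ v : Fin m → Set AP, EquivAux T A e (i + 1) he
        (Fin.snoc (α := fun _ => Fin n → Set AP) x w)
        (Fin.snoc (α := fun _ => Fin m → Set AP) y v) := by
    intro d e hd he hE
    obtain rfl : d = e + 1 := by omega
    exact hE.1 w
  exact key _ _ _ _ h

theorem TupleEquiv.equivTop {AP : Type} {k : ℕ} {T : TransitionSystem AP}
    {A : BuchiAutomaton (Fin k → Set AP)} {n m : ℕ}
    {x : WordTuple AP k n} {y : WordTuple AP k m}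
    (h : TupleEquiv T A k le_rfl x y) : EquivTop T A x y := by
  have key : ∀ (d : ℕ) (hd : k + d = k), EquivAux T A d k hd x y → EquivTop T A x y := by
    intro d hd hE
    obtain rfl : d = 0 := by omega
    exact hE
  exact key _ _ h

/-- Finite index leaves only finitely many finite classes, so the words in them have bounded length
and every larger length qualifies. Hence the infimum is over a nonempty set. -/
theorem blockLength_mem {AP : Type} {k : ℕ} (T : TransitionSystem AP)
    (A : BuchiAutomaton (Fin k → Set AP)) (hk : 0 < k) :
    blockLength T A hk ∈ {ℓ | 0 < ℓ ∧ ∀ n, ℓ ≤ n → ∀ w : Fin n → Set AP,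
      {v : (m : ℕ) × (Fin m → Set AP) |
        TupleEquiv T A 1 hk (fun _ => w) (fun _ => v.2)}.Infinite} := by
  apply Nat.sInf_mem
  obtain ⟨C, _, τ, hτ⟩ := exists_finite_classification T A (k - 1) 1 (Nat.add_sub_of_le hk)
  have hB : ∀ c : C, ∃ B : ℕ,
      {v : (m : ℕ) × (Fin m → Set AP) | c = τ v.1 fun _ => v.2}.Finite →
        ∀ v : (m : ℕ) × (Fin m → Set AP), c = τ v.1 (fun _ => v.2) → v.1 ≤ B := by
    intro c
    by_cases hf : {v : (m : ℕ) × (Fin m → Set AP) | c = τ v.1 fun _ => v.2}.Finite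
    · obtain ⟨B, hB⟩ := (hf.image Sigma.fst).bddAbove
      exact ⟨B, fun _ v hv => hB ⟨v, hv, rfl⟩⟩
    · exact ⟨0, fun h => absurd h hf⟩
  choose B hB using hB
  obtain ⟨N, hN⟩ := (Set.finite_range B).bddAbove
  refine ⟨N + 1, Nat.succ_pos _, fun n hn w hfin => ?_⟩
  simp only [TupleEquiv, hτ] at hfin
  have := hB _ hfin ⟨n, w⟩ rfl
  have := hN ⟨_, rfl⟩ |>.trans' this
  simp only at this
  omega

theorem blockLength_pos {AP : Type} {k : ℕ} (T : TransitionSystem AP)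
    (A : BuchiAutomaton (Fin k → Set AP)) (hk : 0 < k) : 0 < blockLength T A hk :=
  (blockLength_mem T A hk).1

/-- Over a finite alphabet only finitely many words are shorter than `N`, so an infinite class has
another member. It is padded to an infinite word to fit the format of `glue`. -/
theorem exists_long_equiv {AP : Type} [Finite AP] {k : ℕ} (T : TransitionSystem AP)
    (A : BuchiAutomaton (Fin k → Set AP)) (hk : 0 < k) (w : Block AP (blockLength T A hk))
    (N : ℕ) : ∃ (m : ℕ) (v : ℕ → Set AP), N ≤ m ∧
      TupleEquiv T A 1 hk (fun _ => w) (fun _ (x : Fin m) => v x) := by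
  have hinf := (blockLength_mem T A hk).2 _ le_rfl w
  have hfin : {v : (m : ℕ) × (Fin m → Set AP) | v.1 < N}.Finite := by
    have : {v : (m : ℕ) × (Fin m → Set AP) | v.1 < N} =
        Set.range fun v : (m : Fin N) × (Fin m → Set AP) => ⟨v.1, v.2⟩ := by
      ext v
      constructor
      · intro hv
        exact ⟨⟨⟨v.1, hv⟩, v.2⟩, rfl⟩
      · rintro ⟨v, rfl⟩
        exact v.1.2
    rw [this]
    exact Set.finite_range _
  obtain ⟨⟨m, v⟩, hv, hm⟩ := (hinf.sdiff hfin).nonempty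
  refine ⟨m, fun x => if h : x < m then v ⟨x, h⟩ else ∅, not_lt.1 hm, ?_⟩
  simpa using hv


/-! ### A Büchi automaton for the matrix -/

/-- `ρ` is a run on `w` that visits each of the sets `F i` infinitely often. -/
def IsFairRun {X S ι : Type} (δ : X → S → Set X) (F : ι → Set X) (w : ℕ → S) (ρ : ℕ → X) : Prop :=
  (∀ n, ρ (n + 1) ∈ δ (ρ n) (w n)) ∧ ∀ i, {n | ρ n ∈ F i}.Infinite

theorem infinite_setOf_iff {p : ℕ → Prop} : {n | p n}.Infinite ↔ ∀ N, ∃ n, N ≤ n ∧ p n := by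
  rw [← Nat.frequently_atTop_iff_infinite, Filter.frequently_atTop]

/-- The degeneralization counter: the set of fairness conditions met since the last reset. -/
def fairnessCounter {ι : Type} (hit : ℕ → Set ι) : ℕ → Set ι
  | 0 => ∅
  | n + 1 => {i | fairnessCounter hit n ≠ Set.univ ∧ i ∈ fairnessCounter hit n} ∪ hit n

/-- A full counter is reset, so a condition that is not met again stays missing forever. Conversely,
a counter that is never full only grows, and finitely many conditions are all collected eventually.
-/
theorem infinite_fairnessCounter_iff {ι : Type} [Finite ι] (hit : ℕ → Set ι) :
    {n | fairnessCounter hit n = Set.univ}.Infinite ↔ ∀ i, {n | i ∈ hit n}.Infinite := by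
  simp only [infinite_setOf_iff]
  constructor
  · intro h i N
    by_contra! hno
    obtain ⟨n, hn, hu⟩ := h N
    have hstep : ∀ m, i ∉ fairnessCounter hit (n + 1 + m) := by
      intro m
      induction m with
      | zero => exact fun hm => hm.elim (fun hm => hm.1 hu) (hno n hn)
      | succ m ih => exact fun hm => hm.elim (fun hm => ih hm.2) (hno (n + 1 + m) (by omega))
    obtain ⟨m, hm, hu'⟩ := h (n + 1)
    obtain ⟨d, rfl⟩ := Nat.exists_eq_add_of_le hm
    exact hstep d (hu' ▸ Set.mem_univ i)
  · intro h N
    by_contra! hno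
    have hmono : ∀ m d, N ≤ m → fairnessCounter hit m ⊆ fairnessCounter hit (m + d) := by
      intro m d hm
      induction d with
      | zero => exact subset_rfl
      | succ d ih => exact fun i hi => Or.inl ⟨hno (m + d) (by omega), ih hi⟩
    choose f hf hfi using fun i => h i N
    obtain ⟨B, hB⟩ := (Set.finite_range f).bddAbove
    apply hno (max N B + 1) (by omega)
    ext i
    refine iff_of_true ?_ (Set.mem_univ i)
    have hiB : f i ≤ B := hB ⟨i, rfl⟩
    obtain ⟨d, hd⟩ := Nat.exists_eq_add_of_le (show f i + 1 ≤ max N B + 1 by omega)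
    rw [hd]
    exact hmono _ _ ((hf i).trans (Nat.le_succ _)) (Or.inr (hfi i))

/-- Every generalized Büchi automaton with a set of initial states is equivalent to a Büchi
automaton. -/
theorem exists_buchiAutomaton {X S ι : Type} [Finite X] [Finite ι] (I : Set X)
    (δ : X → S → Set X) (F : ι → Set X) :
    ∃ A : BuchiAutomaton S, A.language = {w | ∃ ρ, ρ 0 ∈ I ∧ IsFairRun δ F w ρ} := by
  let upd : Set ι → X → Set ι := fun c x => {i | c ≠ Set.univ ∧ i ∈ c} ∪ {i | x ∈ F i}
  -- The fresh state `none` replaces the set `I`: its transitions guess the first state together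
  -- with the move out of it.
  let A : BuchiAutomaton S :=
    { Q := Option (X × Set ι)
      finite_Q := inferInstance
      init := none
      δ := fun q a => match q with
        | none => {q' | ∃ x ∈ I, ∃ x' ∈ δ x a, q' = some (x', upd ∅ x)}
        | some (x, c) => {q' | ∃ x' ∈ δ x a, q' = some (x', upd c x)}
      F := {q | ∃ x, q = some (x, Set.univ)} }
  refine ⟨A, Set.ext fun w => ⟨?_, ?_⟩⟩
  · rintro ⟨ρ, h0, hstep, hinf⟩
    have h1 := hstep 0
    rw [h0] at h1
    obtain ⟨x0, hx0, x1, hx1, h1⟩ := h1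
    have hsome : ∀ n, ∃ y : X × Set ι, ρ (n + 1) = some y := by
      intro n
      induction n with
      | zero => exact ⟨_, h1⟩
      | succ n ih =>
        obtain ⟨y, hy⟩ := ih
        have h := hstep (n + 1)
        rw [hy] at h
        obtain ⟨x', -, h⟩ := h
        exact ⟨_, h⟩
    choose y hy using hsome
    let ξ : ℕ → X := fun n => Nat.casesOn n x0 fun n => (y n).1
    have hy0 : y 0 = (x1, upd ∅ x0) := Option.some.inj ((hy 0).symm.trans h1)
    have hys : ∀ n, (y (n + 1)).1 ∈ δ (y n).1 (w (n + 1)) ∧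
        (y (n + 1)).2 = upd (y n).2 (y n).1 := by
      intro n
      have h := hstep (n + 1)
      rw [hy, hy] at h
      obtain ⟨x', hx', h⟩ := h
      rw [Option.some.inj h]
      exact ⟨hx', rfl⟩
    have hc : ∀ n, (y n).2 = fairnessCounter (fun n => {i | ξ n ∈ F i}) (n + 1) := by
      intro n
      induction n with
      | zero => rw [hy0]; rfl
      | succ n ih => rw [(hys n).2, ih]; rfl
    refine ⟨ξ, hx0, ?_, (infinite_fairnessCounter_iff fun n => {i | ξ n ∈ F i}).1 ?_⟩
    · intro n
      cases n with
      | zero =>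
        change (y 0).1 ∈ _
        rw [hy0]
        exact hx1
      | succ n => exact (hys n).1
    · rw [infinite_setOf_iff] at hinf ⊢
      intro N
      obtain ⟨n, hn, x, hx⟩ := hinf (N + 1)
      obtain ⟨n, rfl⟩ : ∃ m, n = m + 1 := ⟨n - 1, by omega⟩
      refine ⟨n + 1, by omega, ?_⟩
      rw [← hc, Option.some.inj ((hy n).symm.trans hx)]
  · rintro ⟨ξ, h0, hstep, hinf⟩
    let c := fairnessCounter fun n => {i | ξ n ∈ F i}
    refine ⟨fun n => Nat.casesOn n none fun n => some (ξ (n + 1), c (n + 1)), rfl, ?_, ?_⟩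
    · intro n
      cases n with
      | zero => exact ⟨ξ 0, h0, ξ 1, hstep 0, rfl⟩
      | succ n => exact ⟨ξ (n + 2), hstep (n + 1), rfl⟩
    · have := (infinite_fairnessCounter_iff fun n => {i | ξ n ∈ F i}).2 hinf
      rw [infinite_setOf_iff] at this ⊢
      intro N
      obtain ⟨n, hn, hu⟩ := this (N + 1)
      obtain ⟨n, rfl⟩ : ∃ m, n = m + 1 := ⟨n - 1, by omega⟩
      exact ⟨n + 1, by omega, ξ (n + 1), congrArg (fun c => some (ξ (n + 1), c)) hu⟩

/-- The expansion law alone also allows `b` to stay true without `q` ever occurring. The condition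
`hf` excludes this: unrolling stops at the next position where `b` implies `q`. -/
theorem until_iff {p q b : ℕ → Prop} (hb : ∀ n, b n ↔ q n ∨ (p n ∧ b (n + 1)))
    (hf : ∀ N, ∃ n, N ≤ n ∧ (b n → q n)) (n : ℕ) :
    b n ↔ ∃ j, q (n + j) ∧ ∀ j' < j, p (n + j') := by
  constructor
  · obtain ⟨m, hm, hbq⟩ := hf n
    obtain ⟨d, rfl⟩ := Nat.exists_eq_add_of_le hm
    clear hm
    induction d generalizing n with
    | zero => exact fun h => ⟨0, hbq h, fun _ h => absurd h (Nat.not_lt_zero _)⟩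
    | succ d ih =>
      intro h
      rcases (hb n).1 h with h | ⟨hp, h⟩
      · exact ⟨0, h, fun _ h => absurd h (Nat.not_lt_zero _)⟩
      · obtain ⟨j, hj, hj'⟩ := ih (n + 1) (by rwa [Nat.add_assoc, Nat.add_comm 1 d]) h
        refine ⟨j + 1, by rwa [Nat.add_comm j 1, ← Nat.add_assoc], fun j' hlt => ?_⟩
        cases j' with
        | zero => exact hp
        | succ j' =>
          rw [Nat.add_comm j' 1, ← Nat.add_assoc]
          exact hj' j' (by omega)
  · rintro ⟨j, hj, hj'⟩
    induction j generalizing n with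
    | zero => exact (hb n).2 (Or.inl hj)
    | succ j ih =>
      refine (hb n).2 (Or.inr ⟨hj' 0 (Nat.succ_pos _), ih (n + 1) ?_ fun j' hlt => ?_⟩)
      · rwa [Nat.add_assoc, Nat.add_comm 1 j]
      · rw [Nat.add_assoc, Nat.add_comm 1 j']
        exact hj' _ (by omega)

/-- For each quantifier-free formula there is a finite generalized Büchi automaton that has a fair
run on each word and whose states announce along fair runs whether the suffix to be read satisfies
the formula. -/
theorem QFFormula.exists_truth_automaton {AP Var : Type} (ψ : QFFormula AP Var) :
    ∃ (X ι : Type) (_ : Finite X) (_ : Finite ι) (δ : X → (Var → Set AP) → Set X)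
      (F : ι → Set X) (o : X → Prop),
      (∀ P : Var → Trace AP, ∃ ρ, IsFairRun δ F (merge P) ρ) ∧
      ∀ (P : Var → Trace AP) ρ, IsFairRun δ F (merge P) ρ →
        ∀ n, o (ρ n) ↔ ψ.Sat fun x m => P x (n + m) := by
  induction ψ with
  | atom a x =>
    -- The state guesses whether the letter to be read satisfies the atom, and the transition checks
    -- the guess.
    refine ⟨Prop, Empty, inferInstance, inferInstance, fun q c => {_q' | q ↔ a ∈ c x},
      Empty.elim, id, ?_, ?_⟩
    · exact fun P => ⟨fun n => a ∈ P x n, fun n => Iff.rfl, fun i => i.elim⟩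
    · exact fun P ρ h n => h.1 n
  | neg ψ ih =>
    obtain ⟨X, ι, hX, hι, δ, F, o, he, ho⟩ := ih
    -- Every fair run announces the truth, not merely some run, so negation just flips the
    -- announcement.
    exact ⟨X, ι, hX, hι, δ, F, fun q => ¬ o q, he, fun P ρ h n => not_congr (ho P ρ h n)⟩
  | or ψ₁ ψ₂ ih₁ ih₂ =>
    obtain ⟨X₁, ι₁, _, _, δ₁, F₁, o₁, he₁, ho₁⟩ := ih₁
    obtain ⟨X₂, ι₂, _, _, δ₂, F₂, o₂, he₂, ho₂⟩ := ih₂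
    refine ⟨X₁ × X₂, ι₁ ⊕ ι₂, inferInstance, inferInstance,
      fun q a => {q' | q'.1 ∈ δ₁ q.1 a ∧ q'.2 ∈ δ₂ q.2 a},
      Sum.elim (fun i => {q | q.1 ∈ F₁ i}) (fun i => {q | q.2 ∈ F₂ i}),
      fun q => o₁ q.1 ∨ o₂ q.2, ?_, ?_⟩
    · intro P
      obtain ⟨ρ₁, h₁, f₁⟩ := he₁ P
      obtain ⟨ρ₂, h₂, f₂⟩ := he₂ P
      exact ⟨fun n => (ρ₁ n, ρ₂ n), fun n => ⟨h₁ n, h₂ n⟩, Sum.rec f₁ f₂⟩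
    · rintro P ρ ⟨h, f⟩ n
      exact or_congr (ho₁ P (fun n => (ρ n).1) ⟨fun n => (h n).1, fun i => f (.inl i)⟩ n)
        (ho₂ P (fun n => (ρ n).2) ⟨fun n => (h n).2, fun i => f (.inr i)⟩ n)
  | next ψ ih =>
    obtain ⟨X, ι, _, _, δ, F, o, he, ho⟩ := ih
    refine ⟨X × Prop, ι, inferInstance, inferInstance,
      fun q a => {q' | q'.1 ∈ δ q.1 a ∧ (q.2 ↔ o q'.1)}, fun i => {q | q.1 ∈ F i},
      Prod.snd, ?_, ?_⟩
    · intro P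
      obtain ⟨ρ, h, f⟩ := he P
      exact ⟨fun n => (ρ n, o (ρ (n + 1))), fun n => ⟨h n, Iff.rfl⟩, f⟩
    · rintro P ρ ⟨h, f⟩ n
      refine (h n).2.trans ?_
      refine (ho P (fun n => (ρ n).1) ⟨fun n => (h n).1, f⟩ (n + 1)).trans ?_
      simp only [QFFormula.Sat, Nat.add_assoc]
  -- The remaining case is `until`: a bit obeying the expansion law is guessed, and one more
  -- fairness condition asks that infinitely often it be false or justified by `ψ₂`.
  | _ =>
    rename_i ψ₁ ψ₂ ih₁ ih₂
    obtain ⟨X₁, ι₁, _, _, δ₁, F₁, o₁, he₁, ho₁⟩ := ih₁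
    obtain ⟨X₂, ι₂, _, _, δ₂, F₂, o₂, he₂, ho₂⟩ := ih₂
    have hsat : ∀ (P : Var → Trace AP) n,
        (QFFormula.until ψ₁ ψ₂).Sat (fun x m => P x (n + m)) ↔
          ∃ j, ψ₂.Sat (fun x m => P x (n + j + m)) ∧
            ∀ j' < j, ψ₁.Sat (fun x m => P x (n + j' + m)) := by
      intro P n
      simp only [QFFormula.Sat, Nat.add_assoc]
    refine ⟨X₁ × X₂ × Prop, ι₁ ⊕ ι₂ ⊕ Unit, inferInstance, inferInstance,
      fun q a => {q' | q'.1 ∈ δ₁ q.1 a ∧ q'.2.1 ∈ δ₂ q.2.1 a ∧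
        (q.2.2 ↔ o₂ q.2.1 ∨ (o₁ q.1 ∧ q'.2.2))},
      Sum.elim (fun i => {q | q.1 ∈ F₁ i}) (Sum.elim (fun i => {q | q.2.1 ∈ F₂ i})
        fun _ => {q | q.2.2 → o₂ q.2.1}),
      fun q => q.2.2, ?_, ?_⟩
    · intro P
      obtain ⟨ρ₁, h₁, f₁⟩ := he₁ P
      obtain ⟨ρ₂, h₂, f₂⟩ := he₂ P
      refine ⟨fun n => (ρ₁ n, ρ₂ n, ∃ j, o₂ (ρ₂ (n + j)) ∧ ∀ j' < j, o₁ (ρ₁ (n + j'))),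
        fun n => ⟨h₁ n, h₂ n, ?_⟩, Sum.rec f₁ (Sum.rec f₂ fun _ => ?_)⟩
      · constructor
        · rintro ⟨j, hj, hj'⟩
          cases j with
          | zero => exact Or.inl hj
          | succ j =>
            refine Or.inr ⟨hj' 0 (Nat.succ_pos _), j, ?_, fun j' hlt => ?_⟩
            · rwa [Nat.add_assoc, Nat.add_comm 1 j]
            · rw [Nat.add_assoc, Nat.add_comm 1 j']
              exact hj' _ (by omega)
        · rintro (h | ⟨h, j, hj, hj'⟩)
          · exact ⟨0, h, fun _ h => absurd h (Nat.not_lt_zero _)⟩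
          · refine ⟨j + 1, by rwa [Nat.add_comm j 1, ← Nat.add_assoc], fun j' hlt => ?_⟩
            cases j' with
            | zero => exact h
            | succ j' =>
              rw [Nat.add_comm j' 1, ← Nat.add_assoc]
              exact hj' j' (by omega)
      · refine infinite_setOf_iff.2 fun N => ?_
        by_cases hN : ∃ j, o₂ (ρ₂ (N + j))
        · obtain ⟨j, hj⟩ := hN
          exact ⟨N + j, by omega, fun _ => hj⟩
        · exact ⟨N, le_rfl, fun ⟨j, hj, _⟩ => absurd ⟨j, hj⟩ hN⟩
    · rintro P ρ ⟨h, f⟩ n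
      have hs₁ := ho₁ P (fun n => (ρ n).1) ⟨fun n => (h n).1, fun i => f (.inl i)⟩
      have hs₂ := ho₂ P (fun n => (ρ n).2.1) ⟨fun n => (h n).2.1, fun i => f (.inr (.inl i))⟩
      rw [hsat]
      refine (until_iff (fun n => (h n).2.2) (infinite_setOf_iff.1 (f (.inr (.inr ())))) n).trans ?_
      simp only [hs₁, hs₂]

theorem exists_matrix_automaton {AP : Type} {k : ℕ} (T : TransitionSystem AP)
    (ψ : QFFormula AP (Fin k)) :
    ∃ A : BuchiAutomaton (Fin k → Set AP), A.language = matrixLanguage T ψ := by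
  obtain ⟨X, ι, _, _, δ, F, o, he, ho⟩ := ψ.exists_truth_automaton
  have := T.finite_V
  obtain ⟨A, hA⟩ := exists_buchiAutomaton (X := X × (Fin k → T.V)) (S := Fin k → Set AP)
    {q | o q.1 ∧ ∀ i, q.2 i = T.init}
    (fun q a => {q' | q'.1 ∈ δ q.1 a ∧ ∀ i, T.E (q.2 i) (q'.2 i) ∧ a i = T.label (q.2 i)})
    (fun i => {q | q.1 ∈ F i})
  refine ⟨A, hA.trans (Set.ext fun w => ⟨?_, ?_⟩)⟩
  · rintro ⟨ρ, ⟨h0, hinit⟩, h, f⟩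
    refine ⟨fun i n => w n i, rfl, fun i => ⟨fun n => (ρ n).2 i, hinit i,
      fun n => ((h n).2 i).1, fun n => ((h n).2 i).2⟩, ?_⟩
    have := (ho (fun i n => w n i) (fun n => (ρ n).1) ⟨fun n => (h n).1, f⟩ 0).1 h0
    simpa using this
  · rintro ⟨P, rfl, hP, hs⟩
    obtain ⟨ρ, h, f⟩ := he P
    choose v hv0 hvE hvl using hP
    refine ⟨fun n => (ρ n, fun i => v i n), ⟨?_, hv0⟩,
      fun n => ⟨h n, fun i => ⟨hvE i n, hvl i n⟩⟩, f⟩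
    exact (ho P ρ ⟨h, f⟩ 0).2 (by simpa using hs)


/-! ### Cutting infinite words into blocks -/

/-- `S` is the sequence of starting positions of consecutive nonempty blocks of lengths `L`. -/
structure IsCutting (S L : ℕ → ℕ) : Prop where
  zero : S 0 = 0
  succ : ∀ n, S (n + 1) = S n + L n
  pos : ∀ n, 0 < L n

/-- The index of the block that contains the position `p`. -/
def blockIndex (S : ℕ → ℕ) (p : ℕ) : ℕ := Nat.findGreatest (fun n => S n ≤ p) p

/-- The word whose `n`-th block is a prefix of `g n`. -/
def glue {α : Type} (S : ℕ → ℕ) (g : ℕ → ℕ → α) (p : ℕ) : α :=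
  g (blockIndex S p) (p - S (blockIndex S p))

namespace IsCutting

variable {S L : ℕ → ℕ}

theorem strictMono (h : IsCutting S L) : StrictMono S :=
  strictMono_nat_of_lt_succ fun n => by have := h.succ n; have := h.pos n; omega

theorem blockIndex_add (h : IsCutting S L) {n j : ℕ} (hj : j < L n) :
    blockIndex S (S n + j) = n := by
  rw [blockIndex, Nat.findGreatest_eq_iff]
  refine ⟨(h.strictMono.le_apply).trans (Nat.le_add_right _ _), fun _ => Nat.le_add_right _ _, ?_⟩
  intro m hm _ hle
  have := h.strictMono.monotone (show n + 1 ≤ m from hm)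
  have := h.succ n
  omega

theorem exists_eq_add (h : IsCutting S L) (p : ℕ) : ∃ n j, j < L n ∧ p = S n + j := by
  induction p with
  | zero => exact ⟨0, 0, h.pos 0, by rw [h.zero]⟩
  | succ p ih =>
    obtain ⟨n, j, hj, rfl⟩ := ih
    by_cases hj' : j + 1 < L n
    · exact ⟨n, j + 1, hj', rfl⟩
    · refine ⟨n + 1, 0, h.pos _, ?_⟩
      rw [h.succ]
      omega

theorem glue_add {α : Type} (h : IsCutting S L) (g : ℕ → ℕ → α) {n j : ℕ} (hj : j < L n) :
    glue S g (S n + j) = g n j := by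
  rw [glue, h.blockIndex_add hj, Nat.add_sub_cancel_left]

/-- Runs on consecutive blocks can be joined. -/
theorem exists_join {X : Type} (h : IsCutting S L) {R : ℕ → X → X → Prop} (v : ℕ → X)
    (r : ∀ n, Fin (L n + 1) → X) (h0 : ∀ n, r n 0 = v n) (hl : ∀ n, r n (Fin.last _) = v (n + 1))
    (hR : ∀ n (j : Fin (L n)), R (S n + j) (r n j.castSucc) (r n j.succ)) :
    ∃ ρ : ℕ → X, (∀ p, R p (ρ p) (ρ (p + 1))) ∧ ∀ n (j : Fin (L n + 1)), ρ (S n + j) = r n j := by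
  let ρ := glue S fun n j => if hj : j < L n + 1 then r n ⟨j, hj⟩ else v 0
  have hρ : ∀ n (j : Fin (L n + 1)), ρ (S n + j) = r n j := by
    intro n j
    refine Fin.lastCases ?_ (fun j => ?_) j
    -- The last state of block `n` sits where block `n + 1` starts, so `glue` reads it there; the
    -- shared endpoint `v (n + 1)` makes both agree.
    · have := h.glue_add (fun n j => if hj : j < L n + 1 then r n ⟨j, hj⟩ else v 0)
        (h.pos (n + 1))
      rw [hl, ← h0 (n + 1), Fin.val_last, ← h.succ]
      rw [dif_pos (Nat.succ_pos _)] at this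
      exact this
    · have := h.glue_add (fun n j => if hj : j < L n + 1 then r n ⟨j, hj⟩ else v 0) j.2
      rw [dif_pos (by omega)] at this
      exact this
  refine ⟨ρ, fun p => ?_, hρ⟩
  obtain ⟨n, j, hj, rfl⟩ := h.exists_eq_add p
  have := hR n ⟨j, hj⟩
  rw [← hρ, ← hρ] at this
  exact this

end IsCutting

/-- The states at block boundaries are kept and the run inside each block is replaced, by one
visiting `F` whenever the old segment does. Blocks are finite, so infinitely many of them contain an
accepting visit. -/
theorem mem_language_of_blockwise {α : Type} {A : BuchiAutomaton α} {S L S' L' : ℕ → ℕ}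
    (h : IsCutting S L) (h' : IsCutting S' L') {w w' : ℕ → α}
    (hrun : ∀ n p q, A.HasRun p (fun j : Fin (L n) => w (S n + j)) q →
      A.HasRun p (fun j : Fin (L' n) => w' (S' n + j)) q)
    (hacc : ∀ n p q, A.HasAccRun p (fun j : Fin (L n) => w (S n + j)) q →
      A.HasAccRun p (fun j : Fin (L' n) => w' (S' n + j)) q)
    (hw : w ∈ A.language) : w' ∈ A.language := by
  obtain ⟨ρ, h0, hstep, hinf⟩ := hw
  have hseg : ∀ n, A.IsRun (ρ (S n)) (fun j : Fin (L n) => w (S n + j)) (ρ (S (n + 1)))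
      (fun j : Fin (L n + 1) => ρ (S n + j)) :=
    fun n => ⟨rfl, by simp [h.succ], fun j => hstep (S n + j)⟩
  have hr : ∀ n, ∃ r : Fin (L' n + 1) → A.Q,
      A.IsRun (ρ (S n)) (fun j : Fin (L' n) => w' (S' n + j)) (ρ (S (n + 1))) r ∧
        ((∃ j : Fin (L n + 1), ρ (S n + j) ∈ A.F) → ∃ j, r j ∈ A.F) := by
    intro n
    by_cases ha : ∃ j : Fin (L n + 1), ρ (S n + j) ∈ A.F
    · obtain ⟨r, hr, hj⟩ := hacc n _ _ ⟨_, hseg n, ha⟩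
      exact ⟨r, hr, fun _ => hj⟩
    · obtain ⟨r, hr⟩ := hrun n _ _ ⟨_, hseg n⟩
      exact ⟨r, hr, fun h => absurd h ha⟩
  choose r hr hrF using hr
  obtain ⟨ρ', hρ', hr'⟩ := h'.exists_join (R := fun p q q' => q' ∈ A.δ q (w' p))
    (fun n => ρ (S n)) r (fun n => (hr n).1) (fun n => (hr n).2.1) (fun n => (hr n).2.2)
  refine ⟨ρ', ?_, hρ', ?_⟩
  · have := hr' 0 0
    rw [(hr 0).1, h.zero, h'.zero] at this
    exact this.trans h0
  · rw [infinite_setOf_iff] at hinf ⊢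
    intro N
    obtain ⟨p, hp, hF⟩ := hinf (S N)
    obtain ⟨n, j, hj, rfl⟩ := h.exists_eq_add p
    obtain ⟨j', hj'⟩ := hrF n ⟨⟨j, by omega⟩, hF⟩
    have hn : N < n + 1 := by
      rw [← h.strictMono.lt_iff_lt, h.succ]
      omega
    have := h'.strictMono.le_apply (x := n)
    exact ⟨S' n + j', by omega, by rwa [hr']⟩

theorem mem_traces_of_blockwise {AP : Type} {T : TransitionSystem AP} {S L S' L' : ℕ → ℕ}
    (h : IsCutting S L) (h' : IsCutting S' L') {w w' : Trace AP}
    (hrun : ∀ n u v, T.HasRun u (fun j : Fin (L n) => w (S n + j)) v →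
      T.HasRun u (fun j : Fin (L' n) => w' (S' n + j)) v)
    (hw : w ∈ T.traces) : w' ∈ T.traces := by
  obtain ⟨ρ, h0, hE, hl⟩ := hw
  have hr : ∀ n, T.HasRun (ρ (S n)) (fun j : Fin (L' n) => w' (S' n + j)) (ρ (S (n + 1))) :=
    fun n => hrun n _ _ ⟨fun j => ρ (S n + j), rfl, by simp [h.succ],
      fun j => ⟨hE (S n + j), hl (S n + j)⟩⟩
  choose r hr0 hrl hr using hr
  obtain ⟨ρ', hρ', hr'⟩ := h'.exists_join (R := fun p u v => T.E u v ∧ w' p = T.label u)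
    (fun n => ρ (S n)) r hr0 hrl hr
  refine ⟨ρ', ?_, fun n => (hρ' n).1, fun n => (hρ' n).2⟩
  have := hr' 0 0
  rw [hr0, h.zero, h'.zero] at this
  exact this.trans h0

theorem TransitionSystem.traces_nonempty {AP : Type} (T : TransitionSystem AP) :
    T.traces.Nonempty := by
  choose s hs using T.exists_succ
  exact ⟨fun n => T.label (s^[n] T.init), fun n => s^[n] T.init, rfl,
    fun n => by simpa only [Function.iterate_succ_apply'] using hs _, fun _ => rfl⟩


/-! ### Computable functions on traces are uniformly continuous -/

theorem StreamTM.run_succ {I O : Type} (M : StreamTM I O) (w : ℕ → I) (s : ℕ) :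
    M.run w (s + 1) = M.step w (M.run w s) :=
  Function.iterate_succ_apply' _ _ _

theorem StreamTM.pos_le {I O : Type} (M : StreamTM I O) (w : ℕ → I) (s : ℕ) :
    (M.run w s).pos ≤ s := by
  induction s with
  | zero => exact le_rfl
  | succ s ih =>
    rw [run_succ, step]
    dsimp only
    split <;> omega

theorem StreamTM.run_congr {I O : Type} (M : StreamTM I O) {w w' : ℕ → I} {s : ℕ}
    (h : ∀ p < s, w p = w' p) : M.run w s = M.run w' s := by
  induction s with
  | zero => rfl
  | succ s ih =>
    rw [run_succ, run_succ, ← ih fun p hp => h p (hp.trans (Nat.lt_succ_self s)), step, step,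
      h _ (Nat.lt_succ_of_le (M.pos_le w s))]

theorem StreamTM.Produces.getElem? {I O : Type} {M : StreamTM I O} {w : ℕ → I} {y : ℕ → O}
    (h : M.Produces w y) {s p : ℕ} (hp : p < (M.run w s).output.length) :
    (M.run w s).output[p]? = some (y p) := by
  have := congrArg (fun l => l[p]?) (h.1 s)
  rwa [List.getElem?_ofFn, dif_pos hp] at this

/-- The input head advances by at most one per step, so the output after `s` steps depends on the
first `s` letters only. -/
theorem StreamTM.Produces.exists_modulus {I O : Type} {M : StreamTM I O} {w : ℕ → I} {y : ℕ → O}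
    (h : M.Produces w y) (N : ℕ) : ∃ m, ∀ w' y', M.Produces w' y' → (∀ p < m, w p = w' p) →
      ∀ p < N, y p = y' p := by
  obtain ⟨s, hs⟩ := h.2 N
  refine ⟨s, fun w' y' h' hw p hp => ?_⟩
  have he := M.run_congr hw
  have h1 := h.getElem? (hp.trans_le hs)
  have h2 := h'.getElem? (s := s) (p := p) (he ▸ hp.trans_le hs)
  rw [he, h2] at h1
  exact (Option.some.inj h1).symm

/-- Each tuple of paths has a cylinder neighbourhood on which the pointwise modulus of its labels
applies; the maximum over a finite subcover is uniform. Paths are used instead of traces because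
path conditions are closed in a product of finite discrete spaces. -/
theorem exists_uniform_modulus {AP J O : Type} [Finite J] (T : TransitionSystem AP)
    (f : (J → T.traces) → ℕ → O)
    (hf : ∀ t N, ∃ m, ∀ t', (∀ j, ∀ p < m, (t j : Trace AP) p = (t' j : Trace AP) p) →
      ∀ p < N, f t p = f t' p) (N : ℕ) :
    ∃ m, ∀ t t', (∀ j, ∀ p < m, (t j : Trace AP) p = (t' j : Trace AP) p) →
      ∀ p < N, f t p = f t' p := by
  have := T.finite_V
  let _ : TopologicalSpace T.V := ⊥
  have : DiscreteTopology T.V := ⟨rfl⟩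
  let C : Set (J → ℕ → T.V) := {ρ | ∀ j, ρ j 0 = T.init ∧ ∀ n, T.E (ρ j n) (ρ j (n + 1))}
  have hC : IsCompact C := by
    refine IsClosed.isCompact ?_
    have hCe : C = ⋂ j, ((fun ρ : J → ℕ → T.V => ρ j 0) ⁻¹' {T.init} ∩
        ⋂ n, (fun ρ : J → ℕ → T.V => (ρ j n, ρ j (n + 1))) ⁻¹' {e | T.E e.1 e.2}) := by
      ext ρ
      simp [C]
    rw [hCe]
    refine isClosed_iInter fun j => IsClosed.inter ?_ (isClosed_iInter fun n => ?_)
    · exact (isClosed_discrete _).preimage (by fun_prop)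
    · exact (isClosed_discrete _).preimage (by fun_prop)
  have hlab : ∀ ρ ∈ C, ∃ t : J → T.traces, ∀ j n, (t j : Trace AP) n = T.label (ρ j n) :=
    fun ρ hρ => ⟨fun j => ⟨fun n => T.label (ρ j n), ρ j, (hρ j).1, (hρ j).2, fun _ => rfl⟩,
      fun _ _ => rfl⟩
  have := T.traces_nonempty.to_subtype
  choose! lab hlab using hlab
  choose m hm using fun t => hf t N
  obtain ⟨K, hKC, hcov⟩ := hC.elim_nhds_subcover
    (fun ρ => {ρ' | ∀ j, ∀ p < m (lab ρ), ρ' j p = ρ j p}) (by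
      intro ρ _
      refine IsOpen.mem_nhds ?_ fun _ _ _ => rfl
      have : {ρ' : J → ℕ → T.V | ∀ j, ∀ p < m (lab ρ), ρ' j p = ρ j p} =
          ⋂ j, ⋂ p ∈ Set.Iio (m (lab ρ)), (fun ρ' : J → ℕ → T.V => ρ' j p) ⁻¹' {ρ j p} := by
        ext ρ'
        simp
      rw [this]
      refine isOpen_iInter_of_finite fun j => (Set.finite_Iio _).isOpen_biInter fun p _ => ?_
      exact (isOpen_discrete _).preimage (by fun_prop))
  refine ⟨K.sup fun ρ => m (lab ρ), fun t t' htt p hp => ?_⟩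
  choose ρ h0 hE hl using fun j => (t j).2
  have hρ : ρ ∈ C := fun j => ⟨h0 j, hE j⟩
  obtain ⟨ρ₀, hρ₀, hin⟩ : ∃ ρ₀ ∈ K, ∀ j, ∀ p < m (lab ρ₀), ρ j p = ρ₀ j p := by
    simpa using hcov hρ
  have h1 : ∀ j, ∀ p < m (lab ρ₀), (lab ρ₀ j : Trace AP) p = (t j : Trace AP) p := by
    intro j p hp
    rw [hlab _ (hKC _ hρ₀), hl, hin j p hp]
  have h2 : ∀ j, ∀ p < m (lab ρ₀), (lab ρ₀ j : Trace AP) p = (t' j : Trace AP) p := by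
    intro j p hp
    rw [h1 j p hp]
    exact htt j p (hp.trans_le (Finset.le_sup (f := fun ρ => m (lab ρ)) hρ₀))
  rw [← hm _ t h1 p hp, ← hm _ t' h2 p hp]

/-- A uniformly continuous function on tuples of traces of `T` extends to all tuples of traces. -/
theorem exists_extension {AP J O : Type} [Inhabited O] (T : TransitionSystem AP)
    (f : (J → T.traces) → ℕ → O) {μ : ℕ → ℕ} (hμ : Monotone μ)
    (hf : ∀ N t t', (∀ j, ∀ p < μ N, (t j : Trace AP) p = (t' j : Trace AP) p) →
      ∀ p < N, f t p = f t' p) :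
    ∃ g : (J → Trace AP) → ℕ → O, (∀ t, g (fun j => t j) = f t) ∧
      ∀ N w w', (∀ j, ∀ p < μ N, w j p = w' j p) → ∀ p < N, g w p = g w' p := by
  classical
  -- The value depends on the set `K w p` alone, which is determined by a prefix of `w`; so the
  -- arbitrary choice of a representative does not spoil continuity.
  let e : Set (J → T.traces) → ℕ → O := fun K p => if h : K.Nonempty then f h.some p else default
  let K : (J → Trace AP) → ℕ → Set (J → T.traces) :=
    fun w p => {t | ∀ j, ∀ q < μ (p + 1), (t j : Trace AP) q = w j q}
  refine ⟨fun w p => e (K w p) p, fun t => funext fun p => ?_, fun N w w' hw p hp => ?_⟩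
  · have hne : (K (fun j => t j) p).Nonempty := ⟨t, fun _ _ _ => rfl⟩
    simp only [e, dif_pos hne]
    exact hf (p + 1) _ _ hne.some_mem p (Nat.lt_succ_self p)
  · have : K w p = K w' p := by
      ext t
      refine forall_congr' fun j => forall₂_congr fun q hq => ?_
      rw [hw j q (hq.trans_le (hμ hp))]
    simp only [this]

/-- Computable Skolem functions yield functions on all tuples of traces with a common modulus of
uniform continuity. -/
theorem HasComputableSkolem.exists_uniform {AP : Type} {T : TransitionSystem AP} {k : ℕ}
    {Q : Fin k → Quantifier} {ψ : QFFormula AP (Fin k)}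
    (h : HasComputableSkolem T.traces Q ψ) :
    ∃ (μ : ℕ → ℕ) (G : ∀ j, (Fin j → Trace AP) → Trace AP),
      (∀ j N s s', (∀ j', ∀ p < μ N, s j' p = s' j' p) → ∀ p < N, G j s p = G j s' p) ∧
      ∀ P : Fin k → Trace AP, (∀ i, Q i = .all → P i ∈ T.traces) →
        (∀ i : Fin k, Q i = .ex → P i = G i fun j => P ⟨j, j.2.trans i.2⟩) →
        (∀ i, P i ∈ T.traces) ∧ ψ.Sat P := by
  classical
  obtain ⟨f, hw, hM⟩ := h
  choose M hM using hM
  choose ν hν using fun (i : ExVar Q) => exists_uniform_modulus T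
    (fun t => ((f i t : T.traces) : Trace AP)) (by
      intro t N
      obtain ⟨m, hm⟩ := (hM i t).exists_modulus N
      exact ⟨m, fun t' htt => hm _ _ (hM i t') fun p hp => funext fun j => htt j p hp⟩)
  -- Summing over all variables and all arguments up to `N` gives a bound that is both common and
  -- monotone.
  let μ : ℕ → ℕ := fun N => ∑ i, ∑ n ∈ Finset.range (N + 1), ν i n
  have hμ : Monotone μ := fun a b hab => Finset.sum_le_sum fun i _ =>
    Finset.sum_le_sum_of_subset (Finset.range_mono (Nat.succ_le_succ hab))
  have hνμ : ∀ i N, ν i N ≤ μ N := fun i N =>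
    (Finset.single_le_sum (f := ν i) (fun _ _ => Nat.zero_le _) (Finset.self_mem_range_succ N)).trans
      (Finset.single_le_sum (f := fun i => ∑ n ∈ Finset.range (N + 1), ν i n)
        (fun _ _ => Nat.zero_le _) (Finset.mem_univ i))
  have : Inhabited (Set AP) := ⟨∅⟩
  choose g hgf hgl using fun i : ExVar Q => exists_extension T
    (fun t => ((f i t : T.traces) : Trace AP)) hμ
      (fun N t t' htt => hν i N t t' fun j p hp => htt j p (hp.trans_le (hνμ i N)))
  refine ⟨μ, fun j s => if hj : ∃ h : j < k, Q ⟨j, h⟩ = .ex then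
    g ⟨⟨j, hj.1⟩, hj.2⟩ (fun j' => s ⟨j'.1, j'.2.1⟩) else fun _ => ∅, ?_, ?_⟩
  · intro j N s s' hs p hp
    dsimp only
    split
    · exact hgl _ N _ _ (fun j' q hq => hs _ q hq) p hp
    · rfl
  · intro P hP hPG
    have hPf : ∀ i : ExVar Q, P i.1 = f i (fun j => ⟨P j.1, hP j.1 j.2.2⟩) := by
      intro i
      have hi := hPG i.1 i.2
      dsimp only at hi
      rw [dif_pos (show ∃ h : i.1.1 < k, Q ⟨i.1.1, h⟩ = .ex from ⟨i.1.2, i.2⟩)] at hi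
      rw [hi, ← hgf]
    refine ⟨fun i => ?_, hw P hP hPf⟩
    cases hi : Q i with
    | all => exact hP i hi
    | ex =>
      rw [hPf ⟨i, hi⟩]
      exact Subtype.coe_prop _


/-! ### Winning strategies from computable Skolem functions -/

theorem altPrefix_eq_all {k : ℕ} {i : Fin k} : altPrefix k i = .all ↔ Even (i : ℕ) := by
  simp [altPrefix]

theorem altPrefix_eq_ex {k : ℕ} {i : Fin k} : altPrefix k i = .ex ↔ ¬ Even (i : ℕ) := by
  simp [altPrefix]

theorem delay_anti {k i j : ℕ} (hk : Even k) (hij : i ≤ j) (hj : j < k) :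
    delay k j ≤ delay k i := by
  obtain ⟨c, rfl⟩ := hk
  unfold delay
  split <;> split <;> rename_i h₁ h₂ <;> grind

/-- The strict drop is the one block of lookahead that an existential player has over each earlier
variable; `Simulation.stage_congr` spends it on evaluating the Skolem function. -/
theorem delay_lt {k i j : ℕ} (hk : Even k) (hij : i < j) (hj : j < k) (ho : ¬ Even j) :
    delay k j < delay k i := by
  obtain ⟨c, rfl⟩ := hk
  unfold delay
  split <;> rename_i h₁ <;> grind

theorem delay_pos {k i : ℕ} (hi : i < k) : 0 < delay k i := by
  unfold delay
  split <;> rename_i h₁ <;> grind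

/-- The part of length `len` that starts at position `a`, of a tuple of traces. -/
def segment {AP : Type} {i : ℕ} (s : Fin i → Trace AP) (a len : ℕ) : WordTuple AP i len :=
  fun j p => s j (a + p)

/-! ### Transfer of words between blocks and long segments -/

section Transfer

variable {AP : Type} {k : ℕ} (T : TransitionSystem AP) (A : BuchiAutomaton (Fin k → Set AP))

open Classical in
/-- A word that extends `y` in the way in which `w` extends the equivalent tuple `x`. -/
noncomputable def extendWord {i n m : ℕ} (x : WordTuple AP i n) (y : WordTuple AP i m)
    (w : Fin n → Set AP) : Fin m → Set AP :=
  -- The chosen word is a function of `x`, `y` and `w`, so equal partial information leads to equal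
  -- extensions.
  if h : ∃ (hi : i + 1 ≤ k) (v : Fin m → Set AP), TupleEquiv T A (i + 1) hi
      (Fin.snoc (α := fun _ => Fin n → Set AP) x w)
      (Fin.snoc (α := fun _ => Fin m → Set AP) y v) then
    h.choose_spec.choose
  else fun _ => ∅

theorem tupleEquiv_extendWord {T A} {i n m : ℕ} (hi : i + 1 ≤ k) {x : WordTuple AP i n}
    {y : WordTuple AP i m} (h : TupleEquiv T A i ((Nat.le_succ i).trans hi) x y)
    (w : Fin n → Set AP) :
    TupleEquiv T A (i + 1) hi (Fin.snoc (α := fun _ => Fin n → Set AP) x w)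
      (Fin.snoc (α := fun _ => Fin m → Set AP) y (extendWord T A x y w)) := by
  have h : ∃ (hi : i + 1 ≤ k) (v : Fin m → Set AP), TupleEquiv T A (i + 1) hi
      (Fin.snoc (α := fun _ => Fin n → Set AP) x w)
      (Fin.snoc (α := fun _ => Fin m → Set AP) y v) := ⟨hi, h.exists_snoc hi w⟩
  rw [extendWord, dif_pos h]
  exact h.choose_spec.choose_spec

open Classical in
/-- The counterpart of the block `w` in a long word, padded arbitrarily. -/
noncomputable def stretchBlock {ℓ i : ℕ} (b : Fin i → Block AP ℓ) (s : Fin i → Trace AP)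
    (a len : ℕ) (w : Block AP ℓ) (p : ℕ) : Set AP :=
  if h : p < len then extendWord T A b (segment s a len) w ⟨p, h⟩ else ∅

/-- The block that is the counterpart of a segment of the trace `t`. -/
noncomputable def shrinkSegment {ℓ i : ℕ} (b : Fin i → Block AP ℓ) (s : Fin i → Trace AP)
    (a len : ℕ) (t : Trace AP) : Block AP ℓ :=
  extendWord T A (segment s a len) b fun p => t (a + p)

theorem stretchBlock_congr {ℓ i : ℕ} {b b' : Fin i → Block AP ℓ} {s s' : Fin i → Trace AP}
    {a a' len len' : ℕ} {w w' : Block AP ℓ} (hb : b = b') (ha : a = a') (hl : len = len')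
    (hs : ∀ j, ∀ p < len, s j (a + p) = s' j (a + p)) (hw : w = w') :
    stretchBlock T A b s a len w = stretchBlock T A b' s' a' len' w' := by
  subst hb ha hl hw
  have : segment s a len = segment s' a len := funext fun j => funext fun p => hs j p p.2
  unfold stretchBlock
  rw [this]

theorem shrinkSegment_congr {ℓ i : ℕ} {b b' : Fin i → Block AP ℓ} {s s' : Fin i → Trace AP}
    {a a' len len' : ℕ} {t t' : Trace AP} (hb : b = b') (ha : a = a') (hl : len = len')
    (hs : ∀ j, ∀ p < len, s j (a + p) = s' j (a + p))
    (ht : ∀ p < len, t (a + p) = t' (a + p)) :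
    shrinkSegment T A b s a len t = shrinkSegment T A b' s' a' len' t' := by
  subst hb ha hl
  have h1 : segment s a len = segment s' a len := funext fun j => funext fun p => hs j p p.2
  have h2 : (fun p : Fin len => t (a + p)) = fun p : Fin len => t' (a + p) :=
    funext fun p => ht p p.2
  unfold shrinkSegment
  rw [h1, h2]

end Transfer

/-- The data from which the variable players construct their moves: functions on tuples of traces
with a common modulus of continuity `μ`, and long words equivalent to the blocks. -/
structure Simulation {AP : Type} {k : ℕ} (T : TransitionSystem AP)
    (A : BuchiAutomaton (Fin k → Set AP)) (hk : 0 < k) (ℓ : ℕ) where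
  μ : ℕ → ℕ
  G : ∀ j, (Fin j → Trace AP) → Trace AP
  G_local : ∀ j N s s', (∀ j', ∀ p < μ N, s j' p = s' j' p) → ∀ p < N, G j s p = G j s' p
  len : Block AP ℓ → ℕ → ℕ
  word : Block AP ℓ → ℕ → ℕ → Set AP
  le_len : ∀ w N, N ≤ len w N
  word_equiv : ∀ w N, TupleEquiv T A 1 hk (fun _ => w) (fun _ (p : Fin (len w N)) => word w N p)

/-! ### The simulated game and its locality -/

namespace Simulation

variable {AP : Type} {k : ℕ} {T : TransitionSystem AP} {A : BuchiAutomaton (Fin k → Set AP)}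
  {hk : 0 < k} {ℓ : ℕ} (D : Simulation T A hk ℓ) (u : ℕ → ℕ → Block AP ℓ)

/-- The positions at which the long words start. -/
def cut : ℕ → ℕ
  | 0 => 0
  | n + 1 => cut n + D.len (u 0 n) (D.μ (cut n) + 1)

/-- The lengths of the long words. -/
def width (n : ℕ) : ℕ := D.len (u 0 n) (D.μ (D.cut u n) + 1)

theorem isCutting : IsCutting (D.cut u) (D.width u) :=
  ⟨rfl, fun _ => rfl, fun _ => (Nat.succ_pos _).trans_le (D.le_len _ _)⟩

/-- This is the purpose of the length `μ (cut n) + 1`: Skolem values on the first `n` long words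
depend on at most `n + 1` long words. -/
theorem lt_cut_succ (n : ℕ) : D.μ (D.cut u n) < D.cut u (n + 1) :=
  (D.le_len (u 0 n) (D.μ (D.cut u n) + 1)).trans (Nat.le_add_left _ _)

/-- The simulated traces and the blocks for the first `d + 1` variables, when the blocks `u` are
picked for the universally quantified variables. -/
noncomputable def stage : (d : ℕ) → (Fin (d + 1) → Trace AP) × (Fin (d + 1) → ℕ → Block AP ℓ)
  | 0 => (fun _ => glue (D.cut u) fun n => D.word (u 0 n) (D.μ (D.cut u n) + 1), fun _ => u 0)
  | d + 1 =>
    if Even (d + 1) then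
      (Fin.snoc (α := fun _ => Trace AP) (stage d).1 (glue (D.cut u) fun n =>
        stretchBlock T A (fun j => (stage d).2 j n) (stage d).1 (D.cut u n) (D.width u n)
          (u (d + 1) n)),
        Fin.snoc (α := fun _ => ℕ → Block AP ℓ) (stage d).2 (u (d + 1)))
    else
      (Fin.snoc (α := fun _ => Trace AP) (stage d).1 (D.G (d + 1) (stage d).1),
        Fin.snoc (α := fun _ => ℕ → Block AP ℓ) (stage d).2 fun n =>
          shrinkSegment T A (fun j => (stage d).2 j n) (stage d).1 (D.cut u n) (D.width u n)
            (D.G (d + 1) (stage d).1))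

theorem snoc_apply {α β : Type} {i : ℕ} (x : Fin i → β → α) (y : β → α) (c : β) :
    (fun j => (Fin.snoc (α := fun _ => β → α) x y : Fin (i + 1) → β → α) j c) =
      Fin.snoc (α := fun _ => α) (fun j => x j c) (y c) := by
  funext j
  refine Fin.lastCases ?_ (fun j => ?_) j <;> simp

theorem segment_snoc {i : ℕ} (s : Fin i → Trace AP) (t : Trace AP) (a len : ℕ) :
    segment (Fin.snoc (α := fun _ => Trace AP) s t : Fin (i + 1) → Trace AP) a len =
      Fin.snoc (α := fun _ => Fin len → Set AP) (segment s a len) (fun p => t (a + p)) := by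
  funext j
  refine Fin.lastCases ?_ (fun j => ?_) j <;> funext p <;> simp [segment]

/-- Universal moves extend the equivalence from blocks to segments, Skolem moves extend it from
segments to blocks; the latter needs symmetry of the relation. -/
theorem stage_equiv (d : ℕ) (hd : d + 1 ≤ k) (n : ℕ) :
    TupleEquiv T A (d + 1) hd (fun j => (D.stage u d).2 j n)
      (segment (D.stage u d).1 (D.cut u n) (D.width u n)) := by
  induction d with
  | zero =>
    have h : segment (D.stage u 0).1 (D.cut u n) (D.width u n) =
        fun _ (p : Fin _) => D.word (u 0 n) (D.μ (D.cut u n) + 1) p := funext fun j => funext fun p =>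
      (D.isCutting u).glue_add (fun n => D.word (u 0 n) (D.μ (D.cut u n) + 1)) p.2
    rw [h]
    exact D.word_equiv (u 0 n) (D.μ (D.cut u n) + 1)
  | succ d ih =>
    have ih := ih ((Nat.le_succ _).trans hd)
    rw [stage]
    split
    · simp only [snoc_apply, segment_snoc]
      convert tupleEquiv_extendWord hd ih (u (d + 1) n) using 2
      funext p
      rw [(D.isCutting u).glue_add _ p.2, stretchBlock, dif_pos p.2]
    · simp only [snoc_apply, segment_snoc]
      exact (tupleEquiv_extendWord hd ih.symm _).symm

theorem stage_castSucc (d : ℕ) (j : Fin (d + 1)) :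
    (D.stage u (d + 1)).1 j.castSucc = (D.stage u d).1 j ∧
      (D.stage u (d + 1)).2 j.castSucc = (D.stage u d).2 j := by
  rw [stage]
  split <;> simp

theorem stage_of_le {d e : ℕ} (hde : d ≤ e) (j : ℕ) (hj : j < d + 1) :
    (D.stage u e).1 ⟨j, by omega⟩ = (D.stage u d).1 ⟨j, hj⟩ ∧
      (D.stage u e).2 ⟨j, by omega⟩ = (D.stage u d).2 ⟨j, hj⟩ := by
  induction e, hde using Nat.le_induction with
  | base => exact ⟨rfl, rfl⟩
  | succ e he ih =>
    have := D.stage_castSucc u e ⟨j, by omega⟩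
    exact ⟨this.1.trans ih.1, this.2.trans ih.2⟩

theorem stage_last_even {d : ℕ} (hd : Even d) : (D.stage u d).2 (Fin.last d) = u d := by
  cases d with
  | zero => rfl
  | succ d => rw [stage, if_pos hd]; simp

theorem stage_last_odd {d : ℕ} (hd : ¬ Even d) : (D.stage u d).1 (Fin.last d) =
    D.G d fun j => (D.stage u d).1 j.castSucc := by
  cases d with
  | zero => exact absurd Even.zero hd
  | succ d =>
    have h : (fun j : Fin (d + 1) => (D.stage u (d + 1)).1 j.castSucc) = (D.stage u d).1 :=
      funext fun j => (D.stage_castSucc u d j).1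
    rw [h, stage, if_neg hd]
    simp

variable {u}

theorem cut_congr {u' : ℕ → ℕ → Block AP ℓ} {N : ℕ} (h : ∀ n < N, u 0 n = u' 0 n) {n : ℕ}
    (hn : n ≤ N) : D.cut u n = D.cut u' n := by
  induction n with
  | zero => rfl
  | succ n ih => rw [cut, cut, ih (by omega), h n hn]

/-- The simulated traces and the blocks up to the `(delay k j + r)`-th block of variable `j` depend
only on the corresponding blocks of the universally quantified variables. -/
theorem stage_congr (hk2 : Even k) (r : ℕ) {u' : ℕ → ℕ → Block AP ℓ} (d : ℕ) (hd : d < k)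
    (h : ∀ j ≤ d, Even j → ∀ n < delay k j + r, u j n = u' j n) (j : Fin (d + 1)) :
    (∀ p < D.cut u (delay k j + r), (D.stage u d).1 j p = (D.stage u' d).1 j p) ∧
      ∀ n < delay k j + r, (D.stage u d).2 j n = (D.stage u' d).2 j n := by
  have hcut : ∀ n ≤ delay k 0 + r, D.cut u n = D.cut u' n :=
    fun n hn => D.cut_congr (h 0 (Nat.zero_le _) Even.zero) hn
  have hwidth : ∀ n < delay k 0 + r, D.width u n = D.width u' n := by
    intro n hn
    rw [width, width, hcut n hn.le, h 0 (Nat.zero_le _) Even.zero n hn]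
  have hglue : ∀ (g g' : ℕ → ℕ → Set AP) (N : ℕ), N ≤ delay k 0 + r → (∀ n < N, g n = g' n) →
      ∀ p < D.cut u N, glue (D.cut u) g p = glue (D.cut u') g' p := by
    intro g g' N hN hg p hp
    obtain ⟨n, j, hj, rfl⟩ := (D.isCutting u).exists_eq_add p
    have hn : n < N := by
      rw [← (D.isCutting u).strictMono.lt_iff_lt]
      omega
    rw [(D.isCutting u).glue_add _ hj, hcut n (by omega),
      (D.isCutting u').glue_add _ (hwidth n (by omega) ▸ hj), hg n hn]
  induction d with
  | zero =>
    obtain rfl : j = ⟨0, Nat.one_pos⟩ := Fin.ext (by omega)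
    refine ⟨hglue (fun n => D.word (u 0 n) (D.μ (D.cut u n) + 1))
      (fun n => D.word (u' 0 n) (D.μ (D.cut u' n) + 1)) _ le_rfl fun n hn => ?_,
      h 0 le_rfl Even.zero⟩
    rw [hcut n hn.le, h 0 le_rfl Even.zero n hn]
  | succ d ih =>
    have ih := fun j => ih (by omega) (fun j hj => h j (by omega)) j
    refine Fin.lastCases ?_ (fun j => ?_) j
    · have hd0 : delay k (d + 1) ≤ delay k 0 := delay_anti hk2 (Nat.zero_le _) hd
      have hmono : ∀ j : Fin (d + 1), delay k (d + 1) ≤ delay k j :=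
        fun j => delay_anti hk2 (by omega) hd
      have hb : ∀ n < delay k (d + 1) + r,
          (fun j => (D.stage u d).2 j n) = fun j => (D.stage u' d).2 j n :=
        fun n hn => funext fun j => (ih j).2 n (by have := hmono j; omega)
      have hs : ∀ n < delay k (d + 1) + r, ∀ j, ∀ p < D.width u n,
          (D.stage u d).1 j (D.cut u n + p) = (D.stage u' d).1 j (D.cut u n + p) := by
        intro n hn j p hp
        refine (ih j).1 _ ?_
        have h1 := (D.isCutting u).strictMono.monotone
          (show n + 1 ≤ delay k j + r by have := hmono j; omega)
        have h2 := (D.isCutting u).succ n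
        omega
      rw [stage, stage, Fin.val_last]
      split
      · rename_i he
        simp only [Fin.snoc_last]
        refine ⟨hglue _ _ _ (by omega) fun n hn => ?_, h _ le_rfl he⟩
        exact stretchBlock_congr T A (hb n hn) (hcut n (by omega)) (hwidth n (by omega))
          (hs n hn) (h _ le_rfl he n hn)
      · rename_i ho
        simp only [Fin.snoc_last]
        have hG : ∀ p < D.cut u (delay k (d + 1) + r),
            D.G (d + 1) (D.stage u d).1 p = D.G (d + 1) (D.stage u' d).1 p := by
          refine D.G_local _ _ _ _ fun j p hp => (ih j).1 p ?_
          -- Skolem values before this cut need inputs up to `μ` of it, hence before the next cut.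
          -- As delays drop strictly here, that extra block is already known for all earlier
          -- variables.
          have h1 := D.lt_cut_succ u (delay k (d + 1) + r)
          have h2 := delay_lt hk2 j.2 hd ho
          have h3 := (D.isCutting u).strictMono.monotone
            (show delay k (d + 1) + r + 1 ≤ delay k j + r by omega)
          omega
        refine ⟨hG, fun n hn => ?_⟩
        refine shrinkSegment_congr T A (hb n hn) (hcut n (by omega)) (hwidth n (by omega))
          (hs n hn) fun p hp => hG _ ?_
        have h1 := (D.isCutting u).strictMono.monotone
          (show n + 1 ≤ delay k (d + 1) + r by omega)
        have h2 := (D.isCutting u).succ n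
        omega
    · rw [(D.stage_castSucc u d j).1, (D.stage_castSucc u d j).2, (D.stage_castSucc u' d j).1,
        (D.stage_castSucc u' d j).2]
      exact ih j

open Classical in
/-- The strategies that complete the observed blocks arbitrarily. -/
noncomputable def strategy (i : Fin k) : Strategy AP k ℓ i := fun r h p =>
  (D.stage (fun j n => if hj : ∃ (_ : j < i) (_ : Even j), n < delay k j + r then
      h ⟨⟨j, hj.1.trans i.2⟩, hj.1, altPrefix_eq_all.2 hj.2.1⟩ ⟨n, hj.2.2⟩ else fun _ => ∅) i).2
    (Fin.last i) (firstPick k i r + p)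

/-- Besides naming the pick, the last bound places the index in the range that `stage_congr`
controls in round `r`. -/
theorem exists_eq_firstPick_add {i : ℕ} (hi : i < k) (n : ℕ) :
    ∃ (r : ℕ) (p : Fin (numPicks k i r)), n = firstPick k i r + p ∧ n < delay k i + r := by
  have := delay_pos hi
  by_cases hn : n < delay k i
  · exact ⟨0, ⟨n, hn⟩, by simp [firstPick], hn⟩
  · refine ⟨n - delay k i + 1, ⟨0, by simp [numPicks]⟩, ?_, by omega⟩
    simp only [firstPick, Nat.succ_ne_zero, if_false]
    omega

/-- The dummy blocks that a strategy puts in place of unseen ones do not affect its pick, by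
`stage_congr`. So the round-by-round play agrees with a single simulation on the whole play. -/
theorem eq_stage_of_consistent (hk2 : Even k) {b : Play AP k ℓ}
    (hu : ∀ i : Fin k, u i = b i) (i : Fin k)
    (hb : altPrefix k i = .ex → b.Consistent i (D.strategy i)) :
    b i = (D.stage u i).2 (Fin.last i) := by
  by_cases hi : Even (i : ℕ)
  · rw [D.stage_last_even u hi, hu]
  · funext n
    obtain ⟨r, p, hn, hlt⟩ := exists_eq_firstPick_add i.2 n
    have := hb (altPrefix_eq_ex.2 hi) r p
    rw [← hn] at this
    rw [this, strategy, ← hn]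
    refine (D.stage_congr hk2 r i i.2 (fun j hj he n hn => ?_) (Fin.last i)).2 n hlt
    have hji : j < i := lt_of_le_of_ne hj fun h => hi (h ▸ he)
    rw [dif_pos ⟨hji, he, hn⟩]
    exact congrFun (hu ⟨j, hji.trans i.2⟩).symm n

end Simulation

/-! ### Comparing the play with its simulation -/

theorem isCutting_mul {ℓ : ℕ} (hℓ : 0 < ℓ) : IsCutting (fun n => n * ℓ) fun _ => ℓ :=
  ⟨Nat.zero_mul _, fun n => Nat.succ_mul n ℓ, fun _ => hℓ⟩

theorem Play.outcome_mul_add {AP : Type} {k ℓ : ℕ} (hℓ : 0 < ℓ) (b : Play AP k ℓ) (i : Fin k)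
    (n : ℕ) (j : Fin ℓ) : b.outcome hℓ i (n * ℓ + j) = b i n j := by
  have h1 : (n * ℓ + j) / ℓ = n := by
    rw [Nat.mul_comm, Nat.mul_add_div hℓ, Nat.div_eq_of_lt j.2, Nat.add_zero]
  have h2 : (n * ℓ + j) % ℓ = j := by
    rw [Nat.mul_comm, Nat.mul_add_mod, Nat.mod_eq_of_lt j.2]
  simp only [Play.outcome, h1, h2]

theorem exists_winning_of_computableSkolem {AP : Type} [Finite AP] (T : TransitionSystem AP)
    {k : ℕ} (hk : 0 < k) (hk2 : Even k) (ψ : QFFormula AP (Fin k))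
    (A : BuchiAutomaton (Fin k → Set AP)) (hA : A.language = matrixLanguage T ψ)
    (h : HasComputableSkolem T.traces (altPrefix k) ψ) :
    ∃ σ : StrategyCollection AP k (blockLength T A hk), σ.Winning T A := by
  obtain ⟨μ, G, hG, hsat⟩ := h.exists_uniform
  choose len word hlen hword using exists_long_equiv T A hk
  have hℓ := blockLength_pos T A hk
  revert len word hlen hword hℓ
  generalize blockLength T A hk = ℓ
  intro len word hlen hword hℓ
  let D : Simulation T A hk ℓ := ⟨μ, G, hG, len, word, hlen, hword⟩
  refine ⟨fun i => D.strategy i.1, fun b hb => ⟨hℓ, ?_⟩⟩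
  by_cases hall : ∃ i, altPrefix k i = .all ∧ b.outcome hℓ i ∉ T.traces
  · exact Or.inl hall
  refine Or.inr ?_
  obtain ⟨m, rfl⟩ : ∃ m, k = m + 1 := ⟨k - 1, by omega⟩
  let u : ℕ → ℕ → Block AP ℓ := fun j => if hj : j < m + 1 then b ⟨j, hj⟩ else fun _ _ => ∅
  have hu : ∀ i : Fin (m + 1), u i = b i := fun i => dif_pos i.2
  have hbs : ∀ i : Fin (m + 1), b i = (D.stage u m).2 i := fun i =>
    (D.eq_stage_of_consistent hk2 hu i fun hi => hb ⟨i, hi⟩).trans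
      (D.stage_of_le u (Nat.lt_succ_iff.1 i.2) i (Nat.lt_succ_self _)).2.symm
  have heq : ∀ n, EquivTop T A (fun i => b i n)
      (segment (D.stage u m).1 (D.cut u n) (D.width u n)) := by
    intro n
    have := (D.stage_equiv u m le_rfl n).equivTop
    simpa only [← hbs] using this
  have hout : ∀ n i, (fun j : Fin ℓ => b.outcome hℓ i (n * ℓ + j)) = b i n :=
    fun n i => funext fun j => b.outcome_mul_add hℓ i n j
  -- Paths move from the blocks to the long words, so the simulated universal sequences are traces;
  -- the simulated existential ones are Skolem values by construction.
  have hs := hsat (D.stage u m).1 (fun i hi => by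
      have hi' : b.outcome hℓ i ∈ T.traces := by
        by_contra hno
        exact hall ⟨i, hi, hno⟩
      refine mem_traces_of_blockwise (isCutting_mul hℓ) (D.isCutting u) (fun n p q hr => ?_) hi'
      rw [hout] at hr
      exact ((heq n).2.2 p q i).1 hr) (fun i hi => by
      have h1 := (D.stage_of_le u (Nat.lt_succ_iff.1 i.2) i (Nat.lt_succ_self _)).1
      refine h1.trans ((D.stage_last_odd u (altPrefix_eq_ex.1 hi)).trans ?_)
      refine congrArg (G i) (funext fun j => ?_)
      exact (D.stage_of_le u (Nat.lt_succ_iff.1 i.2) j (by omega)).1.symm)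
  have hmem : merge (D.stage u m).1 ∈ A.language := by
    rw [hA]
    exact ⟨_, rfl, hs⟩
  have hout' : ∀ n, (fun j : Fin ℓ => merge (b.outcome hℓ) (n * ℓ + j)) = fun j i => b i n j :=
    fun n => funext fun j => funext fun i => b.outcome_mul_add hℓ i n j
  refine mem_language_of_blockwise (D.isCutting u) (isCutting_mul hℓ) (fun n p q hr => ?_)
    (fun n p q hr => ?_) hmem
  · rw [hout']
    exact ((heq n).1 p q).2 hr
  · rw [hout']
    exact ((heq n).2.1 p q).2 hr


/-! ### Computable Skolem functions from finite-state strategies -/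

/-! ### Letter-to-word transducers as Turing machines -/

section Mealy

variable {I O X : Type} (step : X → I → X × List O)

/-- The output that a machine for `step` may still have to write. -/
abbrev Pending : Type :=
  {l : List O // ∃ l' ∈ insert [] (Set.range fun c : X × I => (step c.1 c.2).2), l <:+ l'}

theorem finite_pending [Finite I] [Finite X] : Finite (Pending step) := by
  have : {l : List O | ∃ l' ∈ insert [] (Set.range fun c : X × I => (step c.1 c.2).2),
      l <:+ l'}.Finite := by
    have := ((Set.finite_range fun c : X × I => (step c.1 c.2).2).insert []).biUnion
      fun l' _ => (List.finite_toSet l'.tails)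
    refine this.subset ?_
    rintro l ⟨l', hl', h⟩
    exact Set.mem_biUnion hl' ((List.mem_tails _ _).2 h)
  exact this

/-- The machine that reads a letter, writes the output prescribed by `step`, and so on, without
using its working tape. -/
def mealyTM [Finite I] [Finite X] (x₀ : X) : StreamTM I O where
  State := X × Pending step
  finite_State := have := finite_pending step; inferInstance
  Work := Unit
  finite_Work := inferInstance
  inhabited_Work := inferInstance
  start := (x₀, ⟨[], [], Set.mem_insert _ _, List.suffix_rfl⟩)
  next := fun q a _ => match q with
    | (x, ⟨[], _⟩) => ((step x a).1, ⟨(step x a).2, _, Set.mem_insert_of_mem _ ⟨(x, a), rfl⟩,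
        List.suffix_rfl⟩)
    | (x, ⟨_ :: l, h⟩) => (x, ⟨l, h.choose, h.choose_spec.1,
        (List.suffix_cons _ _).trans h.choose_spec.2⟩)
  write := fun _ _ _ => ()
  move := fun _ _ _ => none
  advance := fun q _ _ => q.2.1.isEmpty
  emit := fun q _ _ => q.2.1.head?

variable {step} [Finite I] [Finite X] {x₀ : X} {w : ℕ → I}

theorem mealyTM_step_nil {c : (mealyTM step x₀).Cfg} (h : c.state.2.1 = []) :
    ((mealyTM step x₀).step w c).state.1 = (step c.state.1 (w c.pos)).1 ∧
    ((mealyTM step x₀).step w c).state.2.1 = (step c.state.1 (w c.pos)).2 ∧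
    ((mealyTM step x₀).step w c).pos = c.pos + 1 ∧
    ((mealyTM step x₀).step w c).output = c.output := by
  obtain ⟨⟨x, ⟨l, hl⟩⟩, pos, tape, output⟩ := c
  obtain rfl : l = [] := h
  simp [StreamTM.step, mealyTM]

theorem mealyTM_step_cons {c : (mealyTM step x₀).Cfg} {o : O} {l : List O}
    (h : c.state.2.1 = o :: l) :
    ((mealyTM step x₀).step w c).state.1 = c.state.1 ∧
    ((mealyTM step x₀).step w c).state.2.1 = l ∧
    ((mealyTM step x₀).step w c).pos = c.pos ∧
    ((mealyTM step x₀).step w c).output = c.output ++ [o] := by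
  obtain ⟨⟨x, ⟨l', hl⟩⟩, pos, tape, output⟩ := c
  obtain rfl : l' = o :: l := h
  simp [StreamTM.step, mealyTM]

/-- Pending output is finite and is written without reading, after which the next letter is
consumed; so the machine never stalls. -/
theorem mealyTM_exists_pos (n : ℕ) : ∃ s, ((mealyTM step x₀).run w s).pos = n ∧
    ((mealyTM step x₀).run w s).state.2.1 = [] := by
  have flush : ∀ (l : List O) s, ((mealyTM step x₀).run w s).state.2.1 = l →
      ∃ s', ((mealyTM step x₀).run w s').pos = ((mealyTM step x₀).run w s).pos ∧
        ((mealyTM step x₀).run w s').state.2.1 = [] := by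
    intro l
    induction l with
    | nil => exact fun s hs => ⟨s, rfl, hs⟩
    | cons o l ih =>
      intro s hs
      have hc := mealyTM_step_cons (w := w) hs
      rw [← StreamTM.run_succ] at hc
      obtain ⟨s', h1, h2⟩ := ih (s + 1) hc.2.1
      exact ⟨s', h1.trans hc.2.2.1, h2⟩
  induction n with
  | zero => exact ⟨0, rfl, rfl⟩
  | succ n ih =>
    obtain ⟨s, hp, hs⟩ := ih
    have hc := mealyTM_step_nil (w := w) hs
    rw [← StreamTM.run_succ] at hc
    obtain ⟨s', h1, h2⟩ := flush _ (s + 1) rfl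
    exact ⟨s', by rw [h1, hc.2.2.1, hp], h2⟩

/-- `inv n x m` says that `x` may be the state after reading `n` letters and writing `m` letters
of `y`. -/
theorem mealyTM_produces {y : ℕ → O} (inv : ℕ → X → ℕ → Prop) (h0 : inv 0 x₀ 0)
    (hstep : ∀ n x m, inv n x m → ∃ len,
      (step x (w n)).2 = List.ofFn (fun p : Fin len => y (m + p)) ∧
      inv (n + 1) (step x (w n)).1 (m + len))
    (hlim : ∀ N, ∃ n, ∀ x m, inv n x m → N ≤ m) : (mealyTM step x₀).Produces w y := by
  -- Here `m` counts the letters already written together with the pending ones.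
  have key : ∀ s, ∃ m, inv ((mealyTM step x₀).run w s).pos ((mealyTM step x₀).run w s).state.1 m ∧
      ((mealyTM step x₀).run w s).output ++ ((mealyTM step x₀).run w s).state.2.1 =
        List.ofFn fun p : Fin m => y p := by
    intro s
    induction s with
    | zero => exact ⟨0, h0, rfl⟩
    | succ s ih =>
      obtain ⟨m, hm, ho⟩ := ih
      rw [StreamTM.run_succ]
      cases hl : ((mealyTM step x₀).run w s).state.2.1 with
      | nil =>
        obtain ⟨h1, h2, h3, h4⟩ := mealyTM_step_nil (w := w) hl
        obtain ⟨len, hout, hinv⟩ := hstep _ _ _ hm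
        refine ⟨m + len, by rwa [h1, h3], ?_⟩
        rw [hl, List.append_nil] at ho
        rw [h2, h4, ho, hout, List.ofFn_add]
        rfl
      | cons o l =>
        obtain ⟨h1, h2, h3, h4⟩ := mealyTM_step_cons (w := w) hl
        refine ⟨m, by rwa [h1, h3], ?_⟩
        rw [h2, h4, ← ho, hl, List.append_assoc]
        rfl
  constructor
  · intro s
    obtain ⟨m, -, ho⟩ := key s
    refine List.ext_getElem? fun p => ?_
    rw [List.getElem?_ofFn]
    split
    · rename_i hp
      rw [← List.getElem?_append_left hp, ho, List.getElem?_ofFn, dif_pos]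
      have := congrArg List.length ho
      rw [List.length_append, List.length_ofFn] at this
      omega
    · rename_i hp
      exact List.getElem?_eq_none (not_lt.1 hp)
  · intro N
    obtain ⟨n, hn⟩ := hlim N
    obtain ⟨s, hp, hs⟩ := mealyTM_exists_pos (step := step) (x₀ := x₀) (w := w) n
    obtain ⟨m, hm, ho⟩ := key s
    rw [hs, List.append_nil] at ho
    refine ⟨s, ?_⟩
    rw [ho, List.length_ofFn]
    exact hn _ _ (hp ▸ hm)

end Mealy

theorem firstPick_succ {k i : ℕ} (hi : i < k) (r : ℕ) :
    firstPick k i (r + 1) = firstPick k i r + numPicks k i r := by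
  have := delay_pos hi
  unfold firstPick numPicks
  split <;> split <;> omega

theorem le_firstPick {k i : ℕ} (hi : i < k) (r : ℕ) : r ≤ firstPick k i r := by
  have := delay_pos hi
  unfold firstPick
  split <;> omega

theorem Transducer.foldl_congr {S G : Type} (D : Transducer S G) {c c' : D.Q × List G}
    (h : c.1 = c'.1) {l : List S} (hl : l ≠ []) :
    l.foldl (fun c a => D.δ c.1 a) c = l.foldl (fun c a => D.δ c.1 a) c' := by
  cases l with
  | nil => exact absurd rfl hl
  | cons a l => simp only [List.foldl_cons, h]

/-! ### Finite-state strategies computed through a sliding window -/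

section Lookahead

variable {AP : Type} {k ℓ : ℕ} {i : Fin k}

/-- The block of the variable `j` that starts at position `a` of a list of letters. -/
def blockAt (l : List (UnivBefore (altPrefix k) i → Set AP)) (ℓ a : ℕ)
    (j : UnivBefore (altPrefix k) i) : Block AP ℓ :=
  fun z => (l[a + z]?).elim ∅ fun c => c j

/-- The last columns of an observation, whose blocks are those of the list `l`. -/
def lastColumns (l : List (UnivBefore (altPrefix k) i → Set AP)) (ℓ : ℕ) :
    List (UnivBefore (altPrefix k) i → Option (Block AP ℓ)) :=
  List.ofFn fun (x : Fin (delay k 0)) j =>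
    if (x : ℕ) < delay k j.1 then some (blockAt l ℓ (x * ℓ) j) else none

open Classical in
/-- Simulation of a transducer with delayed columns: the state consists of the state of the
transducer after the columns that are complete and of the letters read since then. -/
noncomputable def lookaheadStep (hℓ : 0 < ℓ)
    (D : Transducer (UnivBefore (altPrefix k) i → Option (Block AP ℓ)) (Block AP ℓ))
    (x : D.Q × {l : List (UnivBefore (altPrefix k) i → Set AP) // l.length < delay k 0 * ℓ})
    (a : UnivBefore (altPrefix k) i → Set AP) :
    (D.Q × {l : List (UnivBefore (altPrefix k) i → Set AP) // l.length < delay k 0 * ℓ}) ×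
      List (Set AP) :=
  if h : (x.2.1 ++ [a]).length < delay k 0 * ℓ then ((x.1, ⟨x.2.1 ++ [a], h⟩), [])
  -- With a full window, the pick of the round comes from a trial run over the partially hidden
  -- columns. The stored state advances past the first column only, the one that is also complete in
  -- all later rounds.
  else (((D.δ x.1 fun j => some (blockAt (x.2.1 ++ [a]) ℓ 0 j)).1, ⟨(x.2.1 ++ [a]).drop ℓ, by
      have := x.2.2
      rw [List.length_drop, List.length_append, List.length_singleton]
      omega⟩),
    (((lastColumns (x.2.1 ++ [a]) ℓ).foldl (fun c a => D.δ c.1 a) (x.1, [])).2.map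
      List.ofFn).flatten)

/-- The state of a transducer after the columns `0, …, r - 1`. -/
def columnState (D : Transducer (UnivBefore (altPrefix k) i → Option (Block AP ℓ)) (Block AP ℓ))
    (b : UnivBefore (altPrefix k) i → ℕ → Block AP ℓ) (r : ℕ) : D.Q × List (Block AP ℓ) :=
  (List.ofFn fun (n : Fin r) j => some (b j n)).foldl (fun c a => D.δ c.1 a) (D.init, [])

theorem columnState_succ
    (D : Transducer (UnivBefore (altPrefix k) i → Option (Block AP ℓ)) (Block AP ℓ))
    (b : UnivBefore (altPrefix k) i → ℕ → Block AP ℓ) (r : ℕ) :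
    columnState D b (r + 1) = D.δ (columnState D b r).1 fun j => some (b j r) := by
  rw [columnState, List.ofFn_succ_last, List.foldl_append]
  rfl

/-- In round `r` the first `r` columns are complete, and only the last `delay k 0` can lack blocks.
This number is positive, so the last transition falls into the window and earlier output is
irrelevant. -/
theorem lastOutput_columns
    (D : Transducer (UnivBefore (altPrefix k) i → Option (Block AP ℓ)) (Block AP ℓ))
    (b : UnivBefore (altPrefix k) i → ℕ → Block AP ℓ) (r : ℕ)
    (l : List (UnivBefore (altPrefix k) i → Set AP))
    (hl : ∀ x < delay k 0, ∀ j, blockAt l ℓ (x * ℓ) j = b j (r + x)) :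
    D.lastOutput (Observation.columns (r := r) fun j n => b j n) =
      ((lastColumns l ℓ).foldl (fun c a => D.δ c.1 a) ((columnState D b r).1, [])).2 := by
  have hcol : Observation.columns (r := r) (fun (j : UnivBefore (altPrefix k) i) n => b j n) =
      (List.ofFn fun (n : Fin r) j => some (b j n)) ++ lastColumns l ℓ := by
    have hadd : ∀ c : ℕ → UnivBefore (altPrefix k) i → Option (Block AP ℓ),
        (List.ofFn fun n : Fin (delay k 0 + r) => c n) =
          (List.ofFn fun n : Fin r => c n) ++ List.ofFn fun x : Fin (delay k 0) => c (r + x) := by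
      intro c
      have := List.ofFn_add (n := r) (m := delay k 0) (f := fun n => c n)
      rw [Nat.add_comm (delay k 0) r]
      exact this
    refine (hadd fun n j => if n < delay k j.1 + r then some (b j n) else none).trans ?_
    congr 1
    · refine congrArg List.ofFn (funext fun n => funext fun j => if_pos ?_)
      omega
    · refine congrArg List.ofFn (funext fun x => funext fun j => ?_)
      rw [hl x x.2 j]
      refine if_congr ?_ rfl rfl
      omega
  rw [Transducer.lastOutput, hcol, List.foldl_append]
  refine congrArg Prod.snd (D.foldl_congr (c := columnState D b r)
    (c' := ((columnState D b r).1, [])) rfl ?_)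
  have := delay_pos i.pos
  intro h
  have := congrArg List.length h
  rw [lastColumns, List.length_ofFn, List.length_nil] at this
  omega

theorem Strategy.FiniteState.exists_streamTM [Finite AP] {σ : Strategy AP k ℓ i}
    (hσ : σ.FiniteState) (hℓ : 0 < ℓ) :
    ∃ M : StreamTM (UnivBefore (altPrefix k) i → Set AP) (Set AP),
      ∀ (t : UnivBefore (altPrefix k) i → Trace AP) (y : Trace AP),
        (∀ r (p : Fin (numPicks k i r)) (z : Fin ℓ), y ((firstPick k i r + p) * ℓ + z) =
          σ r (fun j n z => t j (n * ℓ + z)) p z) → M.Produces (merge t) y := by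
  obtain ⟨D, hD⟩ := hσ
  have := D.finite_Q
  have : Finite {l : List (UnivBefore (altPrefix k) i → Set AP) // l.length < delay k 0 * ℓ} :=
    List.finite_length_lt _ _
  have hΔ : 0 < delay k 0 := delay_pos i.pos
  refine ⟨mealyTM (lookaheadStep hℓ D) (D.init, ⟨[], Nat.mul_pos hΔ hℓ⟩), fun t y hy => ?_⟩
  let b : UnivBefore (altPrefix k) i → ℕ → Block AP ℓ := fun j n z => t j (n * ℓ + z)
  -- `r` counts the rounds answered: the transducer has absorbed `r` columns, the buffer holds the
  -- letters from `r * ℓ` on, and the output covers the blocks picked before round `r`.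
  refine mealyTM_produces (fun n x m => ∃ r, x.1 = (columnState D b r).1 ∧
    n = r * ℓ + x.2.1.length ∧ m = firstPick k i r * ℓ ∧
    ∀ p < x.2.1.length, x.2.1[p]? = some (merge t (r * ℓ + p))) ?_ ?_ ?_
  · exact ⟨0, rfl, by simp, by simp [firstPick], by simp⟩
  · rintro n x m ⟨r, hx, hn, hm, hbuf⟩
    have hbuf' : ∀ p < (x.2.1 ++ [merge t n]).length,
        (x.2.1 ++ [merge t n])[p]? = some (merge t (r * ℓ + p)) := by
      intro p hp
      rw [List.length_append, List.length_singleton] at hp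
      by_cases hp' : p < x.2.1.length
      · rw [List.getElem?_append_left hp', hbuf p hp']
      · obtain rfl : p = x.2.1.length := by omega
        rw [List.getElem?_concat_length, hn]
    rw [lookaheadStep]
    split
    · rename_i hlt
      refine ⟨0, rfl, r, hx, ?_, hm, hbuf'⟩
      rw [List.length_append, hn]
      rfl
    · rename_i hlt
      have hlen : (x.2.1 ++ [merge t n]).length = delay k 0 * ℓ := by
        have := x.2.2
        rw [List.length_append, List.length_singleton] at hlt ⊢
        omega
      have hle : ℓ ≤ delay k 0 * ℓ := Nat.le_mul_of_pos_left ℓ hΔ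
      have hblock : ∀ c < delay k 0, ∀ j,
          blockAt (x.2.1 ++ [merge t n]) ℓ (c * ℓ) j = b j (r + c) := by
        intro c hc j
        funext z
        have hcz : c * ℓ + z < delay k 0 * ℓ := by
          have := Nat.mul_le_mul_right ℓ (Nat.succ_le_of_lt hc)
          rw [Nat.succ_mul] at this
          omega
        simp only [blockAt, hbuf' _ (hcz.trans_eq hlen.symm), Option.elim_some, merge, b,
          Nat.add_mul, Nat.add_assoc]
      refine ⟨numPicks k i r * ℓ, ?_, r + 1, ?_, ?_, ?_, ?_⟩
      · dsimp only
        rw [hx, ← lastOutput_columns D b r _ hblock, hD, List.map_ofFn, List.ofFn_mul]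
        refine congrArg List.flatten (congrArg List.ofFn (funext fun p => ?_))
        refine congrArg List.ofFn (funext fun z => ?_)
        have := hy r p z
        rw [Nat.add_mul, Nat.add_assoc, ← hm] at this
        exact this.symm
      · dsimp only
        have h0 := hblock 0 hΔ
        rw [Nat.zero_mul] at h0
        simp only [columnState_succ, hx, h0, Nat.add_zero]
      · dsimp only
        rw [List.length_drop, hlen, Nat.add_mul, Nat.one_mul, hn]
        rw [List.length_append, List.length_singleton] at hlen
        omega
      · rw [firstPick_succ i.2, Nat.add_mul, hm]
      · intro p hp
        dsimp only at hp ⊢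
        rw [List.length_drop] at hp
        rw [List.getElem?_drop, hbuf' _ (by omega), Nat.add_mul, Nat.one_mul, Nat.add_assoc]
  · intro N
    -- The buffer has fewer than `delay k 0 * ℓ` letters, so by then at least `N` rounds are
    -- answered.
    refine ⟨(N + delay k 0) * ℓ, ?_⟩
    rintro x m ⟨r, -, hn, hm, -⟩
    have h1 := x.2.2
    have h2 : N ≤ r := by
      by_contra hlt
      have := Nat.mul_le_mul_right ℓ (not_le.1 hlt).le
      rw [Nat.add_mul] at hn
      omega
    rw [hm]
    exact (h2.trans (le_firstPick i.2 r)).trans (Nat.le_mul_of_pos_right _ hℓ)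

end Lookahead

/-- No block index is picked twice, so `Function.extend` in `playAgainst` takes the prescribed value
at each pick. -/
theorem injective_pick {k i : ℕ} (hi : i < k) :
    Function.Injective fun c : (r : ℕ) × Fin (numPicks k i r) => firstPick k i c.1 + c.2 := by
  rintro ⟨r, p, hp⟩ ⟨r', p', hp'⟩ h
  have := delay_pos hi
  simp only [firstPick, numPicks] at h hp hp'
  obtain rfl : r = r' := by split at h <;> split at h <;> simp_all <;> omega
  simp at h
  subst h
  rfl

/-! ### The play against given universal traces -/

section Play

variable {AP : Type} {k ℓ : ℕ} (σ : StrategyCollection AP k ℓ)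

open Classical in
/-- The play in which the universally quantified variables are assigned `P` and the variable
players use `σ`. -/
noncomputable def playAgainst (P : Fin k → Trace AP) : Play AP k ℓ := fun i =>
  if h : altPrefix k i = .ex then
    Function.extend (fun c : (r : ℕ) × Fin (numPicks k i r) => firstPick k i c.1 + c.2)
      (fun c => σ ⟨i, h⟩ c.1 (fun j n z => P j.1 (n * ℓ + z)) c.2) fun _ _ => ∅
  else fun n z => P i (n * ℓ + z)

theorem playAgainst_all (P : Fin k → Trace AP) {i : Fin k} (hi : altPrefix k i = .all) :
    playAgainst σ P i = fun n (z : Fin ℓ) => P i (n * ℓ + z) := by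
  rw [playAgainst, dif_neg (by simp [hi])]

theorem playAgainst_ex (P : Fin k → Trace AP) (i : ExVar (altPrefix k)) (r : ℕ)
    (p : Fin (numPicks k i.1 r)) : playAgainst σ P i.1 (firstPick k i.1 r + p) =
      σ i r (fun j n z => P j.1 (n * ℓ + z)) p := by
  rw [playAgainst, dif_pos i.2]
  exact (injective_pick i.1.2).extend_apply _ _ ⟨r, p⟩

/-- This makes the outcome usable as a Skolem function, whose arguments are only the universal
traces before `i`. -/
theorem playAgainst_congr {P P' : Fin k → Trace AP} (i : ExVar (altPrefix k))
    (h : ∀ j : UnivBefore (altPrefix k) i.1, P j.1 = P' j.1) :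
    playAgainst σ P i.1 = playAgainst σ P' i.1 := by
  rw [playAgainst, playAgainst, dif_pos i.2, dif_pos i.2]
  simp only [h]

theorem consistent_playAgainst (P : Fin k → Trace AP) (i : ExVar (altPrefix k)) :
    (playAgainst σ P).Consistent i.1 (σ i) := by
  intro r p
  rw [playAgainst_ex]
  congr
  funext j n
  rw [playAgainst_all σ P j.2.2]

theorem outcome_playAgainst_all (hℓ : 0 < ℓ) (P : Fin k → Trace AP) {i : Fin k}
    (hi : altPrefix k i = .all) : (playAgainst σ P).outcome hℓ i = P i := by
  funext n
  simp only [Play.outcome, playAgainst_all σ P hi]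
  rw [Nat.mul_comm, Nat.div_add_mod]

end Play

theorem hasComputableSkolem_of_winning {AP : Type} [Finite AP] (T : TransitionSystem AP)
    {k ℓ : ℕ} (hℓ : 0 < ℓ) (ψ : QFFormula AP (Fin k))
    (A : BuchiAutomaton (Fin k → Set AP)) (hA : A.language = matrixLanguage T ψ)
    (σ : StrategyCollection AP k ℓ) (hσ : σ.Winning T A) (hfin : ∀ i, (σ i).FiniteState) :
    HasComputableSkolem T.traces (altPrefix k) ψ := by
  classical
  -- Acceptance by `A` forces every component to be a trace, so existential outcomes land in
  -- `T.traces` too.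
  have hwin : ∀ P : Fin k → Trace AP, (∀ i, altPrefix k i = .all → P i ∈ T.traces) →
      (∀ i, (playAgainst σ P).outcome hℓ i ∈ T.traces) ∧
        ψ.Sat ((playAgainst σ P).outcome hℓ) := by
    intro P hP
    obtain ⟨_, ⟨i, hi, hno⟩ | hmem⟩ := hσ (playAgainst σ P) (consistent_playAgainst σ P)
    · exact absurd (outcome_playAgainst_all σ hℓ P hi ▸ hP i hi) hno
    · rw [hA] at hmem
      obtain ⟨P', hP', hmem⟩ := hmem
      have : (playAgainst σ P).outcome hℓ = P' :=
        funext fun i => funext fun n => congrFun (congrFun hP' n) i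
      rwa [this]
  obtain ⟨t₀, ht₀⟩ := T.traces_nonempty
  -- Variables that are not arguments get the dummy trace `t₀`, so that `hwin` applies; by
  -- `playAgainst_congr` the moves for `i` do not depend on it.
  let ext : (i : ExVar (altPrefix k)) → (UnivBefore (altPrefix k) i.1 → T.traces) →
      Fin k → Trace AP :=
    fun i t j => if h : j < i.1 ∧ altPrefix k j = .all then t ⟨j, h⟩ else t₀
  have hext : ∀ i t (j : UnivBefore (altPrefix k) i.1), ext i t j.1 = t j :=
    fun i t j => dif_pos j.2
  have hextT : ∀ i t j, ext i t j ∈ T.traces := by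
    intro i t j
    simp only [ext]
    split
    · exact Subtype.coe_prop _
    · exact ht₀
  refine ⟨fun i t => ⟨(playAgainst σ (ext i t)).outcome hℓ i.1,
    (hwin _ fun j _ => hextT i t j).1 i.1⟩, ?_, ?_⟩
  · intro P hP hPf
    have hout : (playAgainst σ P).outcome hℓ = P := by
      funext i
      cases hi : altPrefix k i with
      | all => exact outcome_playAgainst_all σ hℓ P hi
      | ex =>
        refine Eq.trans ?_ (hPf ⟨i, hi⟩).symm
        have hc := playAgainst_congr σ (P := P)
          (P' := ext ⟨i, hi⟩ fun j => ⟨P j.1, hP j.1 j.2.2⟩) ⟨i, hi⟩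
          fun j => (hext ⟨i, hi⟩ (fun j => ⟨P j.1, hP j.1 j.2.2⟩) j).symm
        exact funext fun n => congrFun (congrFun hc _) _
    rw [← hout]
    exact (hwin P hP).2
  · intro i
    obtain ⟨M, hM⟩ := (hfin i).exists_streamTM hℓ
    refine ⟨M, fun t => hM _ _ fun r p z => ?_⟩
    dsimp only
    rw [Play.outcome_mul_add hℓ, playAgainst_ex]
    simp only [hext]

end HyperLTL

theorem lemma4p5 {AP : Type} [Finite AP] (T : HyperLTL.TransitionSystem AP)
    (k : ℕ) (hk : 0 < k) (hk_even : Even k) (ψ : HyperLTL.QFFormula AP (Fin k)) :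
    (∃ A : HyperLTL.BuchiAutomaton (Fin k → Set AP),
      A.language = HyperLTL.matrixLanguage T ψ) ∧
    ∀ A : HyperLTL.BuchiAutomaton (Fin k → Set AP),
      A.language = HyperLTL.matrixLanguage T ψ →
      ((∃ σ : HyperLTL.StrategyCollection AP k (HyperLTL.blockLength T A hk),
          σ.Winning T A ∧ ∀ i, (σ i).FiniteState) →
        HyperLTL.HasComputableSkolem T.traces (HyperLTL.altPrefix k) ψ) ∧
      (HyperLTL.HasComputableSkolem T.traces (HyperLTL.altPrefix k) ψ →
        ∃ σ : HyperLTL.StrategyCollection AP k (HyperLTL.blockLength T A hk),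
          σ.Winning T A) :=
  ⟨HyperLTL.exists_matrix_automaton T ψ, fun A hA =>
    ⟨fun ⟨σ, hσ, hfin⟩ => HyperLTL.hasComputableSkolem_of_winning T
      (HyperLTL.blockLength_pos T A hk) ψ A hA σ hσ hfin,
    HyperLTL.exists_winning_of_computableSkolem T hk hk_even ψ A hA⟩⟩
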